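/- Let $C$ be a finite set of colors. A tile is a quadruple of colors (left, right, top, bottom), and a tile set is a subset $\tau\subseteq C^4$. A $\tau$-tiling is a map $U:\mathbb{Z}^2\to\tau$ such that the colors on the common side of any two neighboring cells agree; it is periodic if there is a non-zero $T\in\mathbb{Z}^2$ with $U(x+T)=U(x)$ for all $x$, and aperiodic otherwise. For $N>1$, a $\tau$-macro-tile is an $N\times N$ square tiled by matching $\tau$-tiles; the sequence of $N$ colors on each of its sides is called a macro-color, and two macro-tiles match along a side if the corresponding macro-colors are equal. The tile set $\tau$ simulates a set $\rho$ of $N\times N$ $\tau$-macro-tiles if (a) $\tau$-tilings exist and (b) for every $\tau$-tiling there is a unique grid of vertical and horizontal lines that cuts it into $N\times N$ macro-tiles from $\rho$. The tile set $\tau$ is self-similar with zoom factor $N>1$ if it simulates some set $\rho$ of $N\times N$ $\tau$-macro-tiles that is isomorphic to $\tau$, i.e. such that there is a bijection $\tau\to\rho$ that respects (in both directions) the relations "can be placed on the right of" and "can be placed on the top of". Theorem. For every sufficiently large integer $N$ there exists a tile set $\tau$ (over a finite set of colors) that is self-similar with zoom factor $N$. Moreover, $\tau$-tilings exist and all of them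 are aperiodic. -/

import Mathlib

namespace FixedPointTiling

/-- A tile: a unit square whose four sides carry colors from `C` (an element of `C⁴`).
A tile set is a set of such tiles. -/
@[ext] structure Tile (C : Type) where
  left : C
  right : C
  top : C
  bottom : C

/-- The tile `t` can be placed on the right of the tile `s`. -/
def Tile.HMatch {C : Type} (s t : Tile C) : Prop := s.right = t.left

/-- The tile `t` can be placed on the top of the tile `s`. -/
def Tile.VMatch {C : Type} (s t : Tile C) : Prop := s.top = t.bottom

/-- `U` is a tiling of the plane by tiles of `τ` (the first coordinate grows to the right,
the second one grows upwards). -/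
def IsTiling {C : Type} (τ : Set (Tile C)) (U : ℤ × ℤ → Tile C) : Prop :=
  (∀ p, U p ∈ τ) ∧
  (∀ p, (U p).HMatch (U (p + (1, 0)))) ∧
  (∀ p, (U p).VMatch (U (p + (0, 1))))

/-- `U` has a non-zero period. -/
def IsPeriodic {A : Type} (U : ℤ × ℤ → A) : Prop :=
  ∃ T : ℤ × ℤ, T ≠ 0 ∧ ∀ p, U (p + T) = U p

/-- An `N × N` square filled with tiles; `M i j` is in column `i` (from the left)
and row `j` (from the bottom). -/
abbrev Square (C : Type) (N : ℕ) : Type := Fin N → Fin N → Tile C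

/-- A `τ`-macro-tile: an `N × N` square tiled by matching `τ`-tiles. -/
def IsMacroTile {C : Type} {N : ℕ} (τ : Set (Tile C)) (M : Square C N) : Prop :=
  (∀ i j, M i j ∈ τ) ∧
  (∀ i i' j : Fin N, (i : ℕ) + 1 = i' → (M i j).HMatch (M i' j)) ∧
  (∀ i j j' : Fin N, (j : ℕ) + 1 = j' → (M i j).VMatch (M i j'))

section MacroColors

variable {C : Type} {N : ℕ}

/-- The macro-color on the left side of a square. -/
def Square.leftColor (hN : 1 < N) (M : Square C N) : Fin N → C :=
  fun j => (M ⟨0, by omega⟩ j).left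

/-- The macro-color on the right side of a square. -/
def Square.rightColor (hN : 1 < N) (M : Square C N) : Fin N → C :=
  fun j => (M ⟨N - 1, by omega⟩ j).right

/-- The macro-color on the top side of a square. -/
def Square.topColor (hN : 1 < N) (M : Square C N) : Fin N → C :=
  fun i => (M i ⟨N - 1, by omega⟩).top

/-- The macro-color on the bottom side of a square. -/
def Square.bottomColor (hN : 1 < N) (M : Square C N) : Fin N → C :=
  fun i => (M i ⟨0, by omega⟩).bottom

/-- A square regarded as a single tile whose colors are its macro-colors. -/
def Square.toTile (hN : 1 < N) (M : Square C N) : Tile (Fin N → C) where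
  left := M.leftColor hN
  right := M.rightColor hN
  top := M.topColor hN
  bottom := M.bottomColor hN

end MacroColors

/-- The `N × N` block number `z` cut out of `U` by the grid of vertical lines at abscissas
`o.1 + N ℤ` and of horizontal lines at ordinates `o.2 + N ℤ`. -/
def block {C : Type} {N : ℕ} (U : ℤ × ℤ → Tile C) (o : Fin N × Fin N) (z : ℤ × ℤ) :
    Square C N :=
  fun i j => U ((o.1 : ℤ) + N * z.1 + (i : ℤ), (o.2 : ℤ) + N * z.2 + (j : ℤ))

/-- `τ` simulates the set `ρ` of `τ`-macro-tiles: `τ`-tilings exist, and for every `τ`-tiling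
there is a unique grid that cuts it into macro-tiles from `ρ`.
A grid with step `N` is given by its offset modulo `N`. -/
def Simulates {C : Type} {N : ℕ} (τ : Set (Tile C)) (ρ : Set (Square C N)) : Prop :=
  (∀ M ∈ ρ, IsMacroTile τ M) ∧
  (∃ U, IsTiling τ U) ∧
  (∀ U, IsTiling τ U → ∃! o : Fin N × Fin N, ∀ z, block U o z ∈ ρ)

/-- `τ` and the set `ρ` of macro-tiles are isomorphic: there is a bijection that respects
the relations "can be placed on the right of" and "can be placed on the top of". -/
def IsIsomorphic {C : Type} {N : ℕ} (hN : 1 < N) (τ : Set (Tile C)) (ρ : Set (Square C N)) :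
    Prop :=
  ∃ e : τ ≃ ρ,
    (∀ s t : τ, (s : Tile C).HMatch t ↔
      ((e s : Square C N).toTile hN).HMatch ((e t : Square C N).toTile hN)) ∧
    (∀ s t : τ, (s : Tile C).VMatch t ↔
      ((e s : Square C N).toTile hN).VMatch ((e t : Square C N).toTile hN))

/-- `τ` is self-similar with zoom factor `N > 1`. -/
def IsSelfSimilar {C : Type} (τ : Set (Tile C)) (N : ℕ) : Prop :=
  ∃ hN : 1 < N, ∃ ρ : Set (Square C N), Simulates τ ρ ∧ IsIsomorphic hN τ ρ

end FixedPointTiling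

/-! Aperiodicity follows from self-similarity by descent. Uniqueness of the grid makes every period
of a tiling divisible by N, and replacing each macro-tile by the tile it represents yields a tiling
whose period is N times smaller.

For the construction, each edge carries a coordinate modulo N, one bit, and a label from a finite
type independent of N. The constraint `Rule` on the four labels of a cell depends only on its kind
pair, which also ranges over a finite set fixed in advance. A macro-tile that stands for the cell in
column I and row J therefore has one fixed finite table to check, and for large N there is room to
do this by brute force, without a universal machine. The coordinates are held in unary, as one
marked row I and one marked column J. These cross in column J and row I, the transpose of the
represented cell. Since a kind pair includes the kind of the transposed cell, the crossing knows the
kind pair of the represented cell and sends it along row I to a bus. Labels are held one-hot in data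
rows, and each forbidden assignment has a clause column checking that the data differ from it.
Nothing is circular: `Rule` treats kinds as abstract symbols, and the layout is defined from `Rule`
afterwards.

`rule_labels` shows that the intended labels obey the rules, and `exists_labels_eq` that every block
of a tiling carries labels of this form. `IsTiling.coordinates` supplies the grid.
`sideCode_injective` translates equality of colors into equality of macro-colors. A tiling comes
from `exists_tiling_of_expansion`, applied to a blank tile that reappears inside its own macro-tile.
-/

namespace FixedPointTiling

/-! ### Consequences of self-similarity: aperiodicity by descent. -/

section General

variable {C : Type} {N : ℕ}

/-- The residue of an integer modulo `N`. -/
def residue (hN : 1 < N) (x : ℤ) : Fin N :=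
  ⟨(x % N).toNat, by
    have h1 := Int.emod_nonneg x (b := (N : ℤ)) (by omega)
    have h2 := Int.emod_lt_of_pos x (b := (N : ℤ)) (by omega)
    omega⟩

theorem residue_coe (hN : 1 < N) (x : ℤ) : ((residue hN x : ℕ) : ℤ) = x - N * (x / N) := by
  have h1 := Int.emod_nonneg x (b := (N : ℤ)) (by omega)
  have h2 := Int.emod_add_mul_ediv x N
  simp only [residue]
  omega

theorem block_right_eq_left (hN : 1 < N) {τ : Set (Tile C)} {U : ℤ × ℤ → Tile C}
    (hU : IsTiling τ U) (o : Fin N × Fin N) (z : ℤ × ℤ) :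
    ((block U o z).toTile hN).HMatch ((block U o (z + (1, 0))).toTile hN) := by
  funext j
  have h := hU.2.1 ((o.1 : ℤ) + N * z.1 + ((N - 1 : ℕ) : ℤ), (o.2 : ℤ) + N * z.2 + (j : ℤ))
  simp only [Square.toTile, Square.rightColor, Square.leftColor, block]
  refine h.trans ?_
  congr 2
  ext
  · simp; push_cast [Nat.cast_sub hN.le]; ring
  · simp

theorem block_top_eq_bottom (hN : 1 < N) {τ : Set (Tile C)} {U : ℤ × ℤ → Tile C}
    (hU : IsTiling τ U) (o : Fin N × Fin N) (z : ℤ × ℤ) :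
    ((block U o z).toTile hN).VMatch ((block U o (z + (0, 1))).toTile hN) := by
  funext i
  have h := hU.2.2 ((o.1 : ℤ) + N * z.1 + (i : ℤ), (o.2 : ℤ) + N * z.2 + ((N - 1 : ℕ) : ℤ))
  simp only [Square.toTile, Square.topColor, Square.bottomColor, block]
  refine h.trans ?_
  congr 2
  ext
  · simp
  · simp; push_cast [Nat.cast_sub hN.le]; ring

/-- A period of a tiling by a simulating tile set is divisible by the zoom factor. -/
theorem Simulates.dvd_period (hN : 1 < N) {τ : Set (Tile C)} {ρ : Set (Square C N)}
    (h : Simulates τ ρ) {U : ℤ × ℤ → Tile C} (hU : IsTiling τ U) {T : ℤ × ℤ}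
    (hT : ∀ p, U (p + T) = U p) : ∃ S : ℤ × ℤ, T = (N * S.1, N * S.2) := by
  obtain ⟨o, ho, huniq⟩ := h.2.2 U hU
  -- The grid translated by the period T also cuts `U` into macro-tiles of `ρ`, so it is the same
  -- grid and T vanishes modulo N.
  have key := huniq (residue hN (o.1 + T.1), residue hN (o.2 + T.2)) (by
    intro z
    have : block U (residue hN (o.1 + T.1), residue hN (o.2 + T.2)) z =
        block U o (z - (((o.1 : ℤ) + T.1) / N, ((o.2 : ℤ) + T.2) / N)) := by
      funext i j
      simp only [block, residue_coe]
      refine Eq.trans ?_ (hT _)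
      congr 1
      ext
      · simp; ring
      · simp; ring
    rw [this]
    exact ho _)
  have h1 := congrArg (fun q : Fin N × Fin N => ((q.1 : ℕ) : ℤ)) key
  have h2 := congrArg (fun q : Fin N × Fin N => ((q.2 : ℕ) : ℤ)) key
  simp only [residue_coe] at h1 h2
  exact ⟨(((o.1 : ℤ) + T.1) / N, ((o.2 : ℤ) + T.2) / N), Prod.ext (by simp; linarith)
    (by simp; linarith)⟩

/-- Tilings by a self-similar tile set are aperiodic. -/
theorem IsSelfSimilar.not_isPeriodic {τ : Set (Tile C)} (h : IsSelfSimilar τ N)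
    {U : ℤ × ℤ → Tile C} (hU : IsTiling τ U) : ¬ IsPeriodic U := by
  obtain ⟨hN, ρ, hsim, e, heH, heV⟩ := h
  rintro ⟨T, hT0, hT⟩
  induction hn : T.1.natAbs + T.2.natAbs using Nat.strong_induction_on generalizing U T with
  | _ n ih =>
  obtain ⟨S, rfl⟩ := hsim.dvd_period hN hU hT
  obtain ⟨o, ho, -⟩ := hsim.2.2 U hU
  have hS0 : S ≠ 0 := by rintro rfl; simp at hT0
  have hpos : 0 < S.1.natAbs + S.2.natAbs := by
    by_contra hc
    exact hS0 (Prod.ext (by simp; omega) (by simp; omega))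
  -- The descent: reading each block as the tile it represents gives a tiling with period S = T / N.
  refine ih (S.1.natAbs + S.2.natAbs) ?_ (U := fun z => (e.symm ⟨block U o z, ho z⟩ : Tile C))
    ?_ S hS0 ?_ rfl
  · subst hn
    simp only [Int.natAbs_mul, Int.natAbs_natCast]
    nlinarith
  · refine ⟨fun z => (e.symm _).2, fun z => ?_, fun z => ?_⟩
    · rw [heH]
      simpa using block_right_eq_left hN hU o z
    · rw [heV]
      simpa using block_top_eq_bottom hN hU o z
  · intro z
    have : block U o (z + S) = block U o z := by
      funext i j
      simp only [block]
      refine Eq.trans ?_ (hT _)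
      congr 1
      ext
      · simp; ring
      · simp; ring
    simp only [this]

/-! ### Existence of tilings by iterated expansion. -/

/-- The `n`-fold expansion of the tile `t₀`, the cell `o` of each macro-tile being placed over
the origin. -/
def expand (hN : 1 < N) (M : Tile C → Square C N) (t₀ : Tile C) (o : Fin N × Fin N) :
    ℕ → ℤ × ℤ → Tile C
  | 0, _ => t₀
  | n + 1, p => M (expand hN M t₀ o n ((p.1 + o.1) / N, (p.2 + o.2) / N))
      (residue hN (p.1 + o.1)) (residue hN (p.2 + o.2))

/-- Since the cell over the origin is off the border of its block, passing to the parent block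
brings a point at distance at most n + 1 within distance n. This drives the inductions on the level
of expansion. -/
theorem abs_div_le {n : ℕ} {a x : ℤ} (ha : 0 < a) (ha' : a + 1 < N) (hx : |x| ≤ n + 1) :
    |(x + a) / N| ≤ n := by
  have hN : (0 : ℤ) < N := by omega
  rw [abs_le] at hx ⊢
  constructor
  · rw [Int.le_ediv_iff_mul_le hN]
    nlinarith
  · refine Int.lt_add_one_iff.1 ?_
    rw [Int.ediv_lt_iff_lt_mul hN]
    nlinarith

/-- Either `x` and `x + 1` lie in the same block of length `N` or `x` is the last point of
a block. -/
theorem residue_succ (hN : 1 < N) (x : ℤ) :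
    (((residue hN x : ℕ) + 1 = residue hN (x + 1) ∧ (x + 1) / N = x / N)) ∨
    ((residue hN x : ℕ) = N - 1 ∧ (residue hN (x + 1) : ℕ) = 0 ∧ (x + 1) / N = x / N + 1) := by
  have h1 := residue_coe hN x
  have h2 := residue_coe hN (x + 1)
  have l1 := (residue hN x).2
  have l2 := (residue hN (x + 1)).2
  generalize (residue hN x : ℕ) = a at *
  generalize (residue hN (x + 1) : ℕ) = b at *
  generalize hq : x / N = q at *
  generalize hq' : (x + 1) / N = q' at *
  have hlo : q ≤ q' := by rw [← hq, ← hq']; exact Int.ediv_le_ediv (by omega) (by omega)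
  have hhi : q' ≤ q + 1 := by
    by_contra hc
    have : (N : ℤ) * (q + 2) ≤ N * q' := mul_le_mul_of_nonneg_left (by omega) (by omega)
    rw [mul_add] at this
    omega
  rcases (by omega : q' = q ∨ q' = q + 1) with rfl | rfl
  · left; omega
  · right
    rw [mul_add] at h2
    omega

section Expand

variable (hN : 1 < N) {τ : Set (Tile C)} {M : Tile C → Square C N} {t₀ : Tile C}
  {o : Fin N × Fin N}

theorem expand_mem (hM : ∀ t ∈ τ, IsMacroTile τ (M t)) (ht₀ : t₀ ∈ τ) (n : ℕ) (p : ℤ × ℤ) :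
    expand hN M t₀ o n p ∈ τ := by
  induction n generalizing p with
  | zero => exact ht₀
  | succ n ih => exact (hM _ (ih _)).1 _ _

/-- A further expansion changes nothing near the origin: at the origin by self-reproduction of `t₀`,
and elsewhere by passing to the parent blocks. Hence the expansions converge. -/
theorem expand_succ_eq (h₀ : M t₀ o.1 o.2 = t₀)
    (ho1 : 0 < (o.1 : ℕ) ∧ (o.1 : ℕ) + 1 < N) (ho2 : 0 < (o.2 : ℕ) ∧ (o.2 : ℕ) + 1 < N)
    (n : ℕ) (p : ℤ × ℤ) (hp1 : |p.1| ≤ n) (hp2 : |p.2| ≤ n) :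
    expand hN M t₀ o (n + 1) p = expand hN M t₀ o n p := by
  induction n generalizing p with
  | zero =>
    have h1 : p.1 = 0 := by simpa using hp1
    have h2 : p.2 = 0 := by simpa using hp2
    have key : ∀ a : Fin N, residue hN (a : ℤ) = a := by
      intro a
      ext
      simp only [residue]
      rw [Int.emod_eq_of_lt (by omega) (by omega)]
      simp
    simp [expand, h1, h2, key, h₀]
  | succ n ih =>
    rw [expand, ih _ (abs_div_le (by omega) (by omega) (by exact_mod_cast hp1))
      (abs_div_le (by omega) (by omega) (by exact_mod_cast hp2))]
    rfl

/-- Two neighbors lie either in one macro-tile, which is matched internally, or in adjacent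
macro-tiles, whose parents match by induction. -/
theorem expand_hMatch (hM : ∀ t ∈ τ, IsMacroTile τ (M t)) (ht₀ : t₀ ∈ τ)
    (hH : ∀ s ∈ τ, ∀ t ∈ τ, s.HMatch t → ((M s).toTile hN).HMatch ((M t).toTile hN))
    (ho1 : 0 < (o.1 : ℕ) ∧ (o.1 : ℕ) + 1 < N) (ho2 : 0 < (o.2 : ℕ) ∧ (o.2 : ℕ) + 1 < N)
    (n : ℕ) (p : ℤ × ℤ) (hp1 : |p.1| ≤ n) (hp1' : |p.1 + 1| ≤ n) (hp2 : |p.2| ≤ n) :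
    (expand hN M t₀ o n p).HMatch (expand hN M t₀ o n (p + (1, 0))) := by
  induction n generalizing p with
  | zero => rw [abs_le] at hp1 hp1'; omega
  | succ n ih =>
    simp only [expand, Prod.fst_add, Prod.snd_add, add_zero]
    have e : p.1 + 1 + (o.1 : ℤ) = p.1 + o.1 + 1 := by ring
    have b1 := abs_div_le (N := N) (a := o.1) (by omega) (by omega) (by exact_mod_cast hp1)
    have b1' := abs_div_le (N := N) (a := o.1) (by omega) (by omega) (by exact_mod_cast hp1')
    have b2 := abs_div_le (N := N) (a := o.2) (by omega) (by omega) (by exact_mod_cast hp2)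
    rw [e] at b1' ⊢
    rcases residue_succ hN (p.1 + o.1) with ⟨hr, hq⟩ | ⟨hr, hr', hq⟩
    · rw [hq]
      exact (hM _ (expand_mem hN hM ht₀ _ _)).2.1 _ _ _ hr
    · have := hH _ (expand_mem hN hM ht₀ _ _) _ (expand_mem hN hM ht₀ _ _)
        (ih ((p.1 + o.1) / N, (p.2 + o.2) / N) b1 (by rw [hq] at b1'; exact b1') b2)
      have := congrFun this (residue hN (p.2 + o.2))
      simp only [Square.toTile, Square.rightColor, Square.leftColor, Prod.mk_add_mk,
        add_zero] at this
      rw [hq, Fin.ext (a := residue hN (p.1 + o.1)) (b := ⟨N - 1, by omega⟩) hr,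
        Fin.ext (a := residue hN (p.1 + o.1 + 1)) (b := ⟨0, by omega⟩) hr']
      exact this

theorem expand_vMatch (hM : ∀ t ∈ τ, IsMacroTile τ (M t)) (ht₀ : t₀ ∈ τ)
    (hV : ∀ s ∈ τ, ∀ t ∈ τ, s.VMatch t → ((M s).toTile hN).VMatch ((M t).toTile hN))
    (ho1 : 0 < (o.1 : ℕ) ∧ (o.1 : ℕ) + 1 < N) (ho2 : 0 < (o.2 : ℕ) ∧ (o.2 : ℕ) + 1 < N)
    (n : ℕ) (p : ℤ × ℤ) (hp1 : |p.1| ≤ n) (hp2 : |p.2| ≤ n) (hp2' : |p.2 + 1| ≤ n) :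
    (expand hN M t₀ o n p).VMatch (expand hN M t₀ o n (p + (0, 1))) := by
  induction n generalizing p with
  | zero => rw [abs_le] at hp2 hp2'; omega
  | succ n ih =>
    simp only [expand, Prod.fst_add, Prod.snd_add, add_zero]
    have e : p.2 + 1 + (o.2 : ℤ) = p.2 + o.2 + 1 := by ring
    have b1 := abs_div_le (N := N) (a := o.1) (by omega) (by omega) (by exact_mod_cast hp1)
    have b2 := abs_div_le (N := N) (a := o.2) (by omega) (by omega) (by exact_mod_cast hp2)
    have b2' := abs_div_le (N := N) (a := o.2) (by omega) (by omega) (by exact_mod_cast hp2')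
    rw [e] at b2' ⊢
    rcases residue_succ hN (p.2 + o.2) with ⟨hr, hq⟩ | ⟨hr, hr', hq⟩
    · rw [hq]
      exact (hM _ (expand_mem hN hM ht₀ _ _)).2.2 _ _ _ hr
    · have := hV _ (expand_mem hN hM ht₀ _ _) _ (expand_mem hN hM ht₀ _ _)
        (ih ((p.1 + o.1) / N, (p.2 + o.2) / N) b1 b2 (by rw [hq] at b2'; exact b2'))
      have := congrFun this (residue hN (p.1 + o.1))
      simp only [Square.toTile, Square.topColor, Square.bottomColor, Prod.mk_add_mk,
        add_zero] at this
      rw [hq, Fin.ext (a := residue hN (p.2 + o.2)) (b := ⟨N - 1, by omega⟩) hr,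
        Fin.ext (a := residue hN (p.2 + o.2 + 1)) (b := ⟨0, by omega⟩) hr']
      exact this

/-- A substitution with a tile that reproduces itself in the interior of its macro-tile
generates a tiling. -/
theorem exists_tiling_of_expansion (hM : ∀ t ∈ τ, IsMacroTile τ (M t)) (ht₀ : t₀ ∈ τ)
    (hH : ∀ s ∈ τ, ∀ t ∈ τ, s.HMatch t → ((M s).toTile hN).HMatch ((M t).toTile hN))
    (hV : ∀ s ∈ τ, ∀ t ∈ τ, s.VMatch t → ((M s).toTile hN).VMatch ((M t).toTile hN))
    (h₀ : M t₀ o.1 o.2 = t₀)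
    (ho1 : 0 < (o.1 : ℕ) ∧ (o.1 : ℕ) + 1 < N) (ho2 : 0 < (o.2 : ℕ) ∧ (o.2 : ℕ) + 1 < N) :
    ∃ U, IsTiling τ U := by
  have stable : ∀ (p : ℤ × ℤ) (n m : ℕ), |p.1| ≤ n → |p.2| ≤ n → n ≤ m →
      expand hN M t₀ o m p = expand hN M t₀ o n p := by
    intro p n m h1 h2 hnm
    induction m, hnm using Nat.le_induction with
    | base => rfl
    | succ m hm ih =>
      rw [expand_succ_eq hN h₀ ho1 ho2 m p (h1.trans (by exact_mod_cast hm))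
        (h2.trans (by exact_mod_cast hm)), ih]
  let r : ℤ × ℤ → ℕ := fun p => p.1.natAbs + p.2.natAbs
  have hr1 : ∀ p, |p.1| ≤ r p := fun p => by simp only [r, Int.abs_eq_natAbs]; omega
  have hr2 : ∀ p, |p.2| ≤ r p := fun p => by simp only [r, Int.abs_eq_natAbs]; omega
  refine ⟨fun p => expand hN M t₀ o (r p) p, fun p => expand_mem hN hM ht₀ _ _,
    fun p => ?_, fun p => ?_⟩
  · have a := hr1 p
    have b := hr2 p
    have c := hr1 (p + (1, 0))
    have d := hr2 (p + (1, 0))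
    simp only [Prod.fst_add, Prod.snd_add, add_zero] at c d
    dsimp only
    -- Both cells are moved to a common level of expansion, high enough for matching to be known
    -- there.
    rw [← stable p _ (r p + r (p + (1, 0))) a b (by omega),
      ← stable (p + (1, 0)) _ (r p + r (p + (1, 0))) (by simpa using c) (by simpa using d)
        (by omega)]
    exact expand_hMatch hN hM ht₀ hH ho1 ho2 _ _ (by push_cast; omega) (by push_cast; omega)
      (by push_cast; omega)
  · have a := hr1 p
    have b := hr2 p
    have c := hr1 (p + (0, 1))
    have d := hr2 (p + (0, 1))
    simp only [Prod.fst_add, Prod.snd_add, add_zero] at c d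
    dsimp only
    rw [← stable p _ (r p + r (p + (0, 1))) a b (by omega),
      ← stable (p + (0, 1)) _ (r p + r (p + (0, 1))) (by simpa using c) (by simpa using d)
        (by omega)]
    exact expand_vMatch hN hM ht₀ hV ho1 ho2 _ _ (by push_cast; omega) (by push_cast; omega)
      (by push_cast; omega)

end Expand

end General

/-! ### Labels and local rules -/

/-- The place of a cell on a line of cells of a macro-tile. -/
inductive Side | first | mid | last
  deriving DecidableEq

instance : Fintype Side := ⟨{.first, .mid, .last}, by rintro ⟨⟩ <;> simp⟩

/-- The role of a row of a macro-tile: it is `outer` if it carries a bit of the left and a bit of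
the right macro-color, and `inner` if it carries a pair of bits between the two sides only. -/
inductive RowUse | idle | outer | inner
  deriving DecidableEq

instance : Fintype RowUse := ⟨{.idle, .outer, .inner}, by rintro ⟨⟩ <;> simp⟩

/-- The role of a column of a macro-tile: `outer` as for rows, `clause` if it checks
that the pairs of bits in the rows differ from a forbidden assignment, `bus` if it distributes
the kind of the macro-tile. -/
inductive ColUse | idle | outer | clause | bus
  deriving DecidableEq

instance : Fintype ColUse := ⟨{.idle, .outer, .clause, .bus}, by rintro ⟨⟩ <;> simp⟩

/-- The interaction of a row and a column in a cell. -/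
inductive Gate | plain | turn | compare (x : Bool × Bool) | emit (s : Fin 32)
  deriving DecidableEq, Fintype

/-- The kind of a cell of a macro-tile. -/
structure Kind where
  col : Side
  row : Side
  rowUse : RowUse
  colUse : ColUse
  gate : Gate
  deriving DecidableEq, Fintype

/-- The kind of a cell together with the kind of the transposed cell. -/
abbrev KindPair : Type := Kind × Kind

/-- The code length 32 itself enters `Gate` through `emit`, so it must cover the kinds it creates:
(3·3·3·4·38)² ≤ 2^32. -/
theorem card_kindPair_le : Fintype.card KindPair ≤ Fintype.card (Fin 32 → Bool) := by
  have h : Fintype.card Kind ≤ Fintype.card (Side × Side × RowUse × ColUse × Gate) :=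
    Fintype.card_le_of_injective
      (fun k : Kind => (k.col, k.row, k.rowUse, k.colUse, k.gate)) (by
        rintro ⟨⟩ ⟨⟩ h; simpa using h)
  have h1 : Fintype.card Side = 3 := rfl
  have h2 : Fintype.card RowUse = 3 := rfl
  have h3 : Fintype.card ColUse = 4 := rfl
  have h4 : Fintype.card Gate = 38 := rfl
  simp only [Fintype.card_prod, h1, h2, h3, h4] at h
  simp only [KindPair, Fintype.card_prod, Fintype.card_fun, Fintype.card_bool, Fintype.card_fin]
  nlinarith

/-- A binary code for pairs of kinds. -/
noncomputable def kindCode : KindPair ↪ (Fin 32 → Bool) :=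
  Classical.choice (Function.Embedding.nonempty_of_card_le card_kindPair_le)

/-- The information carried by an edge apart from the coordinates. -/
@[ext] structure Label where
  mark : Bool
  state : Fin 3
  pair : Bool × Bool
  sym : Option KindPair
  deriving DecidableEq

noncomputable instance : Fintype Label :=
  haveI : Finite Label := Finite.of_injective
    (fun x : Label => (x.mark, x.state, x.pair, x.sym)) (by
      intro x y h
      simp only [Prod.mk.injEq] at h
      exact Label.ext h.1 h.2.1 h.2.2.1 h.2.2.2)
  Fintype.ofFinite Label

/-- The state of the scanner that looks for the unique mark: `0` if it has not been met, `1` if it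
has just been met and `2` afterwards. -/
def step (s : Fin 3) (m : Bool) : Fin 3 := if m then 1 else if s = 0 then 0 else 2

/-- Marks run straight along the rows. In the last column they are moved up by one row, while
the column checks that there is exactly one of them. -/
structure MarkRule (c r : Side) (l l' d : Label) : Prop where
  straight : c ≠ .last → l'.mark = l.mark
  shift : c = .last → l'.mark = decide (d.state = 1)
  idle : r ≠ .last → l.state = 0 ∧ l'.state = 0
  once : r = .last → c ≠ .first → d.mark = true → l.state = 0
  -- The incoming state is discarded in the first cell. This leaves the border state free to record
  -- whether the scanned mark is in the last place, in which case `shift` wraps it to place 0.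
  run : r = .last → l'.state = step (if c = .first then 0 else l.state) d.mark
  found : r = .last → c = .last → l'.state ≠ 0

/-- A value runs along a line between the two end cells, outside it is `z`. -/
def InnerRule {A : Type} (z : A) : Side → A → A → Prop
  | .first, x, _ => x = z
  | .mid, x, y => y = x
  | .last, _, y => y = z

/-- Two bits run along a line; the first one is visible at the beginning of the line,
the second one at its end. -/
def OuterRule : Side → Bool × Bool → Bool × Bool → Prop
  | .first, x, y => x.1 = x.2 ∧ y.1 = x.1
  | .mid, x, y => y = x
  | .last, x, y => y.2 = x.2 ∧ y.1 = y.2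

/-- The value on the part of a line between its end cells that is adjacent to a cell. -/
def innerValue {A : Type} (c : Side) (x y : A) : A := if c = .last then x else y

/-- The row carries a pair different from the one the gate compares with. -/
def mismatch (x : Bool × Bool) : Gate → Bool
  | .compare y => decide (x ≠ y)
  | _ => false

/-- A clause column: the bit records whether a mismatch has been met. -/
structure ClauseRule (r : Side) (g : Gate) (x d u : Bool × Bool) : Prop where
  snd : d.2 = false ∧ u.2 = false
  init : r = .first → d.1 = false
  run : r ≠ .last → u.1 = (d.1 || mismatch x g)
  found : r = .last → d.1 = true ∧ u.1 = false

/-- The constraint on the labels on the left, right, bottom and top side of a cell. -/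
structure Rule (k : KindPair) (l r d u : Label) : Prop where
  markH : MarkRule k.1.col k.1.row l r d
  markV : MarkRule k.1.row k.1.col d u l
  symH : InnerRule none k.1.col l.sym r.sym
  symOff : l.mark = false → innerValue k.1.col l.sym r.sym = none
  -- The crossing of the marked lines is the transpose of the represented cell, hence the swap. It
  -- may lie in a border column, hence `innerValue`.
  symOn : l.mark = true → d.mark = true → innerValue k.1.col l.sym r.sym = some k.swap
  symIdle : k.1.colUse ≠ .bus → d.sym = none ∧ u.sym = none
  symV : k.1.colUse = .bus → InnerRule none k.1.row d.sym u.sym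
  symRead : k.1.colUse = .bus → l.mark = true → innerValue k.1.row d.sym u.sym = l.sym
  rowIdle : k.1.rowUse = .idle → l.pair = (false, false) ∧ r.pair = (false, false)
  rowOuter : k.1.rowUse = .outer → OuterRule k.1.col l.pair r.pair
  rowInner : k.1.rowUse = .inner → InnerRule (false, false) k.1.col l.pair r.pair
  colIdle : k.1.colUse = .idle ∨ k.1.colUse = .bus →
    d.pair = (false, false) ∧ u.pair = (false, false)
  colOuter : k.1.colUse = .outer → OuterRule k.1.row d.pair u.pair
  colClause : k.1.colUse = .clause → ClauseRule k.1.row k.1.gate l.pair d.pair u.pair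
  turn : k.1.gate = .turn → l.pair = d.pair
  emit : ∀ s, k.1.gate = .emit s →
    ∃ g, d.sym = some g ∧ l.pair = (kindCode g s, kindCode g s)

/-! ### The layout of a macro-tile -/

/-- The rows that carry pairs of bits: for every label `s` the bits "the left (right) label is `s`"
and "the bottom (top) label is `s`", and the bits of the code of the kind. -/
abbrev DataIdx : Type := Label ⊕ Label ⊕ Fin 32

/-- The special columns: the bus, the columns that carry "the bottom (top) label is `s`", and
a column for every assignment of pairs of bits to the data rows. -/
abbrev ColIdx : Type := Unit ⊕ Label ⊕ (DataIdx → Bool × Bool)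

section Place

variable {A : Type} [Fintype A]

/-- Positions for the elements of a finite type, beginning with `1`. -/
noncomputable def place (a : A) : ℕ := Fintype.equivFin A a + 1

/-- The element at a position, if any. -/
noncomputable def unplace (A : Type) [Fintype A] (n : ℕ) : Option A :=
  if h : 0 < n ∧ n - 1 < Fintype.card A then some ((Fintype.equivFin A).symm ⟨n - 1, h.2⟩)
  else none

theorem place_pos (a : A) : 0 < place a := Nat.succ_pos _

theorem place_le (a : A) : place a ≤ Fintype.card A := (Fintype.equivFin A a).2

theorem unplace_eq_some {n : ℕ} {a : A} : unplace A n = some a ↔ n = place a := by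
  unfold unplace place
  split_ifs with h
  · rw [Option.some_inj, Equiv.symm_apply_eq, Fin.ext_iff]
    dsimp only
    omega
  · have := (Fintype.equivFin A a).2
    simp only [false_iff]
    omega

theorem unplace_place (a : A) : unplace A (place a) = some a := unplace_eq_some.2 rfl

theorem unplace_eq_none {n : ℕ} (h : n = 0 ∨ Fintype.card A < n) : unplace A n = none := by
  unfold unplace
  rw [dif_neg (by omega)]

end Place

/-- The pairs of bits in the data rows of a macro-tile. -/
noncomputable def dataOf (k : KindPair) (l r d u : Label) : DataIdx → Bool × Bool
  | .inl s => (decide (l = s), decide (r = s))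
  | .inr (.inl s) => (decide (d = s), decide (u = s))
  | .inr (.inr s) => (kindCode k s, kindCode k s)

/-- The assignment comes from labels that satisfy the rule for the kind it encodes. -/
def Allowed (α : DataIdx → Bool × Bool) : Prop :=
  ∃ k l r d u, Rule k l r d u ∧ dataOf k l r d u = α

/-- The role of a row. -/
def rowUse : Option DataIdx → RowUse
  | none => .idle
  | some (.inl _) => .outer
  | some (.inr _) => .inner

open Classical in
/-- The role of a column. -/
noncomputable def colUse : Option ColIdx → ColUse
  | none => .idle
  | some (.inl _) => .bus
  | some (.inr (.inl _)) => .outer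
  | some (.inr (.inr α)) => if Allowed α then .idle else .clause

/-- The interaction of a column and a row. -/
def gate : Option ColIdx → Option DataIdx → Gate
  | some (.inl _), some (.inr (.inr s)) => .emit s
  | some (.inr (.inl s)), some (.inr (.inl s')) => if s = s' then .turn else .plain
  | some (.inr (.inr α)), some k => .compare (α k)
  | _, _ => .plain

/-- The place of the cell number `i` on a line of `N` cells. -/
def side (N i : ℕ) : Side := if i = 0 then .first else if i + 1 = N then .last else .mid

/-- The kind of the cell in column `i` and row `j`. -/
noncomputable def kind (N i j : ℕ) : Kind where
  col := side N i
  row := side N j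
  rowUse := rowUse (unplace DataIdx j)
  colUse := colUse (unplace ColIdx i)
  gate := gate (unplace ColIdx i) (unplace DataIdx j)

/-- The kinds of a cell and of the transposed cell. -/
noncomputable def kindPair (N i j : ℕ) : KindPair := (kind N i j, kind N j i)

/-! ### The labels in a macro-tile -/

/-- Marks: row `I` is marked up to the last column, after it the next row is. -/
def markLine (N I i j : ℕ) : Bool := decide (j = if i = N then (I + 1) % N else I)

/-- The states of the scanner that meets the mark in place `J`. -/
def scan (N J i : ℕ) : Fin 3 :=
  if i = 0 then (if J + 1 = N then 1 else 2) else if i ≤ J then 0 else if i = J + 1 then 1 else 2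

/-- The states of the scanner, which runs along the last line. -/
def stateLine (N J i j : ℕ) : Fin 3 := if j + 1 = N then scan N J i else 0

/-- A value on the inner part of a line. -/
def innerLine {A : Type} (N : ℕ) (z v : A) (i : ℕ) : A := if i = 0 ∨ i = N then z else v

/-- Two bits on a line. -/
def outerLine (N : ℕ) (x : Bool × Bool) (i : ℕ) : Bool × Bool :=
  (if i = N then x.2 else x.1, if i = 0 then x.1 else x.2)

/-- The pairs on a row. -/
def rowPair (N : ℕ) (D : DataIdx → Bool × Bool) (i : ℕ) : Option DataIdx → Bool × Bool
  | none => (false, false)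
  | some (.inl s) => outerLine N (D (.inl s)) i
  | some (.inr s) => innerLine N (false, false) (D (.inr s)) i

open Classical in
/-- The pairs on a column. -/
noncomputable def colPair (N : ℕ) (D : DataIdx → Bool × Bool) (j : ℕ) :
    Option ColIdx → Bool × Bool
  | none => (false, false)
  | some (.inl _) => (false, false)
  | some (.inr (.inl s)) => outerLine N (D (.inr (.inl s))) j
  | some (.inr (.inr α)) =>
    if Allowed α then (false, false) else (decide (j < N ∧ ∃ k, place k < j ∧ D k ≠ α k), false)

/-- The label on the left side of the cell in column `i` and row `j`. -/
noncomputable def hLabel (N I J : ℕ) (D : DataIdx → Bool × Bool) (i j : ℕ) : Label where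
  mark := markLine N I i j
  state := stateLine N J i j
  pair := rowPair N D i (unplace DataIdx j)
  sym := if j = I then innerLine N none (some (kindPair N I J)) i else none

/-- The label on the bottom side of the cell in column `i` and row `j`. -/
noncomputable def vLabel (N I J : ℕ) (D : DataIdx → Bool × Bool) (i j : ℕ) : Label where
  mark := markLine N J j i
  state := stateLine N I j i
  pair := colPair N D j (unplace ColIdx i)
  sym := if i = place (Sum.inl () : ColIdx) then innerLine N none (some (kindPair N I J)) j
    else none

/-- The macro-tile is large enough for its layout. -/
def LargeEnough (N : ℕ) : Prop := Fintype.card DataIdx + Fintype.card ColIdx + 5 ≤ N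

/-! ### The labels of a macro-tile satisfy the rules -/

section Lines

variable {N : ℕ}

theorem side_eq_first {i : ℕ} : side N i = .first ↔ i = 0 := by
  unfold side; split_ifs <;> simp_all

theorem side_eq_last (hN : 1 < N) {i : ℕ} : side N i = .last ↔ i + 1 = N := by
  unfold side; split_ifs <;> simp_all; omega

theorem side_eq_mid {i : ℕ} (h0 : 0 < i) (h1 : i + 1 < N) : side N i = .mid := by
  unfold side; rw [if_neg (by omega), if_neg (by omega)]

theorem side_cases (hN : 1 < N) {i : ℕ} (hi : i < N) :
    (i = 0 ∧ side N i = .first) ∨ (0 < i ∧ i + 1 < N ∧ side N i = .mid) ∨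
      (0 < i ∧ i + 1 = N ∧ side N i = .last) := by
  by_cases h0 : i = 0
  · exact Or.inl ⟨h0, side_eq_first.2 h0⟩
  by_cases h1 : i + 1 = N
  · exact Or.inr (Or.inr ⟨by omega, h1, (side_eq_last hN).2 h1⟩)
  · exact Or.inr (Or.inl ⟨by omega, by omega, side_eq_mid (by omega) (by omega)⟩)

theorem innerRule_innerLine (hN : 1 < N) {A : Type} (z v : A) {i : ℕ} (hi : i < N) :
    InnerRule z (side N i) (innerLine N z v i) (innerLine N z v (i + 1)) := by
  rcases side_cases hN hi with ⟨h, hs⟩ | ⟨h, h', hs⟩ | ⟨h, h', hs⟩ <;> rw [hs]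
  · simp [InnerRule, innerLine, h]
  · simp only [InnerRule, innerLine]
    rw [if_neg (by omega), if_neg (by omega)]
  · simp [InnerRule, innerLine, h']

theorem innerRule_self {A : Type} (z : A) (c : Side) : InnerRule z c z z := by
  cases c <;> simp [InnerRule]

theorem innerValue_innerLine (hN : 1 < N) {A : Type} (z v : A) {i : ℕ} (hi : i < N) :
    innerValue (side N i) (innerLine N z v i) (innerLine N z v (i + 1)) = v := by
  unfold innerValue innerLine
  rcases side_cases hN hi with ⟨h, hs⟩ | ⟨h, h', hs⟩ | ⟨h, h', hs⟩ <;> rw [hs]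
  · rw [if_neg (by simp), if_neg (by omega)]
  · rw [if_neg (by simp), if_neg (by omega)]
  · rw [if_pos rfl, if_neg (by omega)]

theorem outerRule_outerLine (hN : 1 < N) (x : Bool × Bool) {i : ℕ} (hi : i < N) :
    OuterRule (side N i) (outerLine N x i) (outerLine N x (i + 1)) := by
  rcases side_cases hN hi with ⟨h, hs⟩ | ⟨h, h', hs⟩ | ⟨h, h', hs⟩ <;> rw [hs]
  · subst h
    have h0 : ¬ 0 = N := by omega
    have h1 : ¬ 0 + 1 = N := by omega
    simp only [OuterRule, outerLine, if_neg h0, if_neg h1]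
    simp
  · simp only [OuterRule, outerLine]
    rw [if_neg (by omega), if_neg (by omega), if_neg (by omega), if_neg (by omega)]
  · simp only [OuterRule, outerLine]
    rw [if_neg (by omega), if_neg (by omega), if_pos h']
    exact ⟨rfl, rfl⟩

/-- Serves rows and columns alike: marks and states are symmetric under transposition together with
the exchange of I and J. -/
theorem markRule_of_lines (hN : 1 < N) {I J i j : ℕ} (hI : I < N) (hJ : J < N) (hi : i < N)
    (hj : j < N) {l l' d : Label}
    (hl : l.mark = markLine N I i j) (hl' : l'.mark = markLine N I (i + 1) j)
    (hd : d.mark = markLine N J j i)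
    (sl : l.state = stateLine N J i j) (sl' : l'.state = stateLine N J (i + 1) j)
    (sd : d.state = stateLine N I j i) :
    MarkRule (side N i) (side N j) l l' d := by
  constructor
  · intro h
    rw [Ne, side_eq_last hN] at h
    rw [hl, hl', markLine, markLine, if_neg h, if_neg (by omega)]
  · intro h
    rw [side_eq_last hN] at h
    rw [hl', sd, markLine, stateLine, if_pos h, if_pos h, decide_eq_decide, scan]
    rcases (by omega : I + 1 = N ∨ I + 1 < N) with h1 | h1
    · rw [h1, Nat.mod_self]
      split_ifs <;> simp <;> omega
    · rw [Nat.mod_eq_of_lt h1]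
      split_ifs <;> simp <;> omega
  · intro h
    rw [Ne, side_eq_last hN] at h
    rw [sl, sl', stateLine, stateLine, if_neg h, if_neg h]
    exact ⟨rfl, rfl⟩
  · intro h h' hm
    rw [Ne, side_eq_first] at h'
    rw [side_eq_last hN] at h
    rw [hd, markLine, if_neg (by omega), decide_eq_true_eq] at hm
    rw [sl, stateLine, if_pos h, scan, if_neg h', if_pos (by omega)]
  · intro h
    rw [side_eq_last hN] at h
    have hjN : ¬ j = N := by omega
    simp only [side_eq_first, sl, sl', hd, stateLine, if_pos h, markLine, if_neg hjN, step, scan,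
      decide_eq_true_eq]
    split_ifs <;> first | rfl | omega | simp_all
  · intro h h'
    rw [side_eq_last hN] at h h'
    rw [sl', stateLine, if_pos h, scan, if_neg (by omega), if_neg (by omega)]
    split_ifs <;> simp

end Lines

section Sound

variable {N I J : ℕ} {xl xr xd xu : Label}

theorem LargeEnough.one_lt (h : LargeEnough N) : 1 < N := by
  unfold LargeEnough at h; omega

theorem LargeEnough.row_lt (h : LargeEnough N) (k : DataIdx) : place k + 1 < N := by
  have h2 := place_le k
  unfold LargeEnough at h
  omega

theorem LargeEnough.col_lt (h : LargeEnough N) (k : ColIdx) : place k + 1 < N := by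
  have h2 := place_le k
  unfold LargeEnough at h
  omega

theorem rowPair_inner (D : DataIdx → Bool × Bool) (k : DataIdx) {i : ℕ}
    (h0 : 0 < i) (h1 : i < N) : rowPair N D i (some k) = D k := by
  rcases k with s | s
  · simp only [rowPair, outerLine]
    rw [if_neg (by omega), if_neg (by omega)]
  · simp only [rowPair, innerLine]
    rw [if_neg (by omega)]

theorem colUse_eq_bus {i : ℕ} :
    colUse (unplace ColIdx i) = .bus ↔ i = place (Sum.inl () : ColIdx) := by
  rw [← unplace_eq_some]
  rcases unplace ColIdx i with _ | ⟨⟨⟩⟩ | s | α <;> simp [colUse]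
  split_ifs <;> simp

theorem colUse_eq_clause {i : ℕ} (h : colUse (unplace ColIdx i) = .clause) :
    ∃ α, ¬ Allowed α ∧ i = place (Sum.inr (Sum.inr α) : ColIdx) := by
  simp only [← unplace_eq_some]
  rcases hu : unplace ColIdx i with _ | ⟨⟨⟩⟩ | s | α <;> simp [colUse, hu] at h
  exact ⟨α, h, rfl⟩

/-- An allowed `D` differs from the forbidden `α` in some data row, and all data rows lie below the
last row, so the mismatch is recorded in time. -/
theorem clauseRule_colPair (hN : LargeEnough N) {D α : DataIdx → Bool × Bool}
    (hα : ¬ Allowed α) (hD : Allowed D) {i j : ℕ}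
    (hi : i = place (Sum.inr (Sum.inr α) : ColIdx)) (hj : j < N) :
    ClauseRule (side N j) (gate (unplace ColIdx i) (unplace DataIdx j))
      (rowPair N D i (unplace DataIdx j)) (colPair N D j (unplace ColIdx i))
      (colPair N D (j + 1) (unplace ColIdx i)) := by
  have hi0 : 0 < i := hi ▸ place_pos _
  have hiN : i < N := by have := hN.col_lt (Sum.inr (Sum.inr α)); omega
  rw [hi, unplace_place, ← hi]
  simp only [colPair, if_neg hα]
  constructor
  · exact ⟨rfl, rfl⟩
  · intro h
    rw [side_eq_first] at h
    subst h
    simp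
  · intro h
    rw [Ne, side_eq_last hN.one_lt] at h
    have hm : mismatch (rowPair N D i (unplace DataIdx j))
        (gate (some (Sum.inr (Sum.inr α))) (unplace DataIdx j)) =
        decide (∃ k, place k = j ∧ D k ≠ α k) := by
      rcases hu : unplace DataIdx j with _ | k
      · simp only [gate, mismatch]
        symm
        rw [decide_eq_false_iff_not]
        rintro ⟨k, hk, -⟩
        rw [← hk, unplace_place] at hu
        cases hu
      · rw [rowPair_inner D k hi0 hiN]
        rw [unplace_eq_some] at hu
        simp only [gate, mismatch, decide_eq_decide]
        refine ⟨fun h => ⟨k, hu.symm, h⟩, ?_⟩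
        rintro ⟨k', hk', h'⟩
        have : k' = k := by
          rw [hu] at hk'
          simpa [unplace_place] using congrArg (unplace DataIdx) hk'
        exact this ▸ h'
    rw [hm, ← Bool.decide_or, decide_eq_decide]
    constructor
    · rintro ⟨-, k, hk, h'⟩
      rcases (by omega : place k < j ∨ place k = j) with h1 | h1
      · exact Or.inl ⟨hj, k, h1, h'⟩
      · exact Or.inr ⟨k, h1, h'⟩
    · rintro (⟨-, k, hk, h'⟩ | ⟨k, hk, h'⟩)
      · exact ⟨by omega, k, by omega, h'⟩
      · exact ⟨by omega, k, by omega, h'⟩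
  · intro h
    rw [side_eq_last hN.one_lt] at h
    refine ⟨?_, by simp [h]⟩
    rw [decide_eq_true_eq]
    refine ⟨hj, ?_⟩
    have hne : D ≠ α := fun h => hα (h ▸ hD)
    obtain ⟨k, hk⟩ := Function.ne_iff.1 hne
    exact ⟨k, by have := hN.row_lt k; omega, hk⟩

theorem gate_eq_turn {a : Option ColIdx} {b : Option DataIdx} (h : gate a b = .turn) :
    ∃ s : Label, a = some (.inr (.inl s)) ∧ b = some (.inr (.inl s)) := by
  unfold gate at h
  split at h <;> try simp at h
  subst h
  exact ⟨_, rfl, rfl⟩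

theorem gate_eq_emit {a : Option ColIdx} {b : Option DataIdx} {s : Fin 32}
    (h : gate a b = .emit s) : a = some (.inl ()) ∧ b = some (.inr (.inr s)) := by
  unfold gate at h
  split at h
  · simp only [Gate.emit.injEq] at h
    exact ⟨rfl, by rw [h]⟩
  · split_ifs at h
  · simp at h
  · simp at h

/-- The labels of the macro-tile of an admissible cell satisfy the rules. -/
theorem rule_labels (hN : LargeEnough N) (hI : I < N) (hJ : J < N)
    (hR : Rule (kindPair N I J) xl xr xd xu) {D : DataIdx → Bool × Bool}
    (hD : D = dataOf (kindPair N I J) xl xr xd xu) {i j : ℕ} (hi : i < N) (hj : j < N) :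
    Rule (kindPair N i j) (hLabel N I J D i j) (hLabel N I J D (i + 1) j)
      (vLabel N I J D i j) (vLabel N I J D i (j + 1)) := by
  have h1 := hN.one_lt
  have hDA : Allowed D := ⟨_, _, _, _, _, hR, hD.symm⟩
  constructor
  · exact markRule_of_lines h1 hI hJ hi hj rfl rfl rfl rfl rfl rfl
  · exact markRule_of_lines h1 hJ hI hj hi rfl rfl rfl rfl rfl rfl
  · simp only [hLabel, kindPair, kind]
    by_cases hjI : j = I
    · simp only [if_pos hjI]
      exact innerRule_innerLine h1 _ _ hi
    · simp only [if_neg hjI]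
      exact innerRule_self _ _
  · intro h
    simp only [hLabel, markLine, decide_eq_false_iff_not] at h
    rw [if_neg (by omega)] at h
    simp [hLabel, h, innerValue]
  · intro h h'
    simp only [hLabel, vLabel, markLine, decide_eq_true_eq] at h h'
    rw [if_neg (by omega)] at h h'
    simp only [hLabel, if_pos h, kindPair, kind]
    -- Here i = J and j = I, so the swapped kind pair of this cell is `kindPair N I J`.
    rw [innerValue_innerLine h1 _ _ hi, h, h']
    rfl
  · intro h
    have : i ≠ place (Sum.inl () : ColIdx) := fun hc => h (colUse_eq_bus.2 hc)
    simp [vLabel, this]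
  · intro h
    have h := colUse_eq_bus.1 h
    simp only [vLabel, if_pos h]
    exact innerRule_innerLine h1 _ _ hj
  · intro h hm
    have h := colUse_eq_bus.1 h
    simp only [hLabel, markLine, decide_eq_true_eq] at hm
    rw [if_neg (by omega)] at hm
    simp only [hLabel, vLabel, if_pos h, if_pos hm, kindPair, kind]
    rw [innerValue_innerLine h1 _ _ hj, innerLine, if_neg]
    have := place_pos (Sum.inl () : ColIdx)
    omega
  · intro h
    simp only [kindPair, kind] at h
    rcases hu : unplace DataIdx j with _ | s | s <;> simp_all [rowUse, hLabel, rowPair]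
  · intro h
    simp only [kindPair, kind] at h
    rcases hu : unplace DataIdx j with _ | s | s <;> simp [rowUse, hu] at h
    simp only [hLabel, hu, rowPair]
    exact outerRule_outerLine h1 _ hi
  · intro h
    simp only [kindPair, kind] at h
    rcases hu : unplace DataIdx j with _ | s | s <;> simp [rowUse, hu] at h
    simp only [hLabel, hu, rowPair]
    exact innerRule_innerLine h1 _ _ hi
  · intro h
    simp only [kindPair, kind] at h
    rcases hu : unplace ColIdx i with _ | s | s | α
    · simp [vLabel, hu, colPair]
    · simp [vLabel, hu, colPair]
    · simp [colUse, hu] at h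
    · have hα : Allowed α := by
        by_contra hα
        simp [colUse, hu, hα] at h
      simp [vLabel, hu, colPair, hα]
  · intro h
    simp only [kindPair, kind] at h
    rcases hu : unplace ColIdx i with _ | s | s | α <;> simp [colUse, hu] at h
    · simp only [vLabel, hu, colPair]
      exact outerRule_outerLine h1 _ hj
    · split_ifs at h
  · intro h
    obtain ⟨α, hα, hi'⟩ := colUse_eq_clause h
    exact clauseRule_colPair hN hα hDA hi' hj
  · intro h
    obtain ⟨s, ha, hb⟩ := gate_eq_turn h
    simp only [hLabel, vLabel, ha, hb]
    have ha := unplace_eq_some.1 ha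
    have hb := unplace_eq_some.1 hb
    have := hN.row_lt (.inr (.inl s))
    have := place_pos (A := DataIdx) (.inr (.inl s))
    rw [rowPair_inner D _ (ha ▸ place_pos _) hi]
    simp only [colPair, outerLine]
    rw [if_neg (by omega), if_neg (by omega)]
  · intro s h
    obtain ⟨ha, hb⟩ := gate_eq_emit h
    have ha' := unplace_eq_some.1 ha
    have hb' := unplace_eq_some.1 hb
    refine ⟨kindPair N I J, ?_, ?_⟩
    · simp only [vLabel, if_pos ha', innerLine]
      rw [if_neg]
      have := hN.row_lt (.inr (.inr s))
      have := place_pos (A := DataIdx) (.inr (.inr s))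
      omega
    · simp only [hLabel, hb]
      rw [rowPair_inner D _ (ha' ▸ place_pos _) hi, hD]
      rfl

end Sound

/-! ### The rules determine the labels of a macro-tile -/

section LineUniqueness

variable {N : ℕ}

/-- A scanner meets exactly one mark. -/
theorem exists_mark {w : ℕ → Bool} {s : ℕ → Fin 3}
    (hrun : ∀ j < N, s (j + 1) = step (if j = 0 then 0 else s j) (w j))
    (honce : ∀ j < N, j ≠ 0 → w j = true → s j = 0) (hN : 0 < N) (hfound : s N ≠ 0) :
    ∃ I < N, (∀ j < N, w j = decide (j = I)) ∧ ∀ j, 0 < j → j ≤ N → s j = scan N I j := by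
  have zero : ∀ m ≤ N, (∀ j < m, w j = false) → ∀ j, 0 < j → j ≤ m → s j = 0 := by
    intro m hm hw j
    induction j with
    | zero => intro h; omega
    | succ j ih =>
      intro _ hj
      rw [hrun j (by omega), hw j (by omega)]
      by_cases h0 : j = 0
      · simp [h0, step]
      · simp [h0, step, ih (by omega) (by omega)]
  have hex : ∃ j, j < N ∧ w j = true := by
    by_contra hc
    push Not at hc
    exact hfound (zero N le_rfl (fun j hj => by simpa using hc j hj) N hN le_rfl)
  classical
  obtain ⟨I, ⟨hI, hwI⟩, hmin⟩ := Nat.findX hex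
  have hbefore : ∀ j < I, w j = false := fun j hj => by
    have := hmin j hj
    simpa [hj.trans hI] using this
  have hsI : s (I + 1) = 1 := by
    rw [hrun I hI, hwI]
    simp [step]
  have hafter : ∀ m, I + m + 1 ≤ N → s (I + m + 1) = if m = 0 then 1 else 2 := by
    intro m
    induction m with
    | zero => intro _; simpa using hsI
    | succ m ih =>
      intro hm
      have hs := ih (by omega)
      have hne : s (I + m + 1) ≠ 0 := by rw [hs]; split_ifs <;> simp
      have hw : w (I + m + 1) = false := by
        by_contra hc
        exact hne (honce _ (by omega) (by omega) (by simpa using hc))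
      rw [show I + (m + 1) + 1 = I + m + 1 + 1 by ring, hrun _ (by omega), hw,
        if_neg (by omega), step, if_neg (by simp), if_neg hne, if_neg (by omega)]
  refine ⟨I, hI, fun j hj => ?_, fun j h0 hj => ?_⟩
  · rcases lt_trichotomy j I with h | h | h
    · rw [hbefore j h, eq_comm, decide_eq_false_iff_not]; omega
    · simp [h, hwI]
    · rw [eq_comm, decide_eq_false_iff_not.2 (by omega), eq_comm]
      by_contra hc
      have h1 := honce j hj (by omega) (by simpa using hc)
      have h2 := hafter (j - I - 1) (by omega)
      rw [show I + (j - I - 1) + 1 = j by omega, h1] at h2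
      split_ifs at h2 <;> simp at h2
  · unfold scan
    rw [if_neg (by omega)]
    by_cases h : j ≤ I
    · rw [if_pos h]
      exact zero I hI.le hbefore j h0 h
    · rw [if_neg h]
      have h2 := hafter (j - I - 1) (by omega)
      rw [show I + (j - I - 1) + 1 = j by omega] at h2
      rw [h2]
      congr 1
      rw [eq_iff_iff]
      omega

theorem eq_of_straight {A : Type} {f : ℕ → A}
    (h : ∀ i, 0 < i → i + 1 < N → f (i + 1) = f i) {i : ℕ} (h0 : 0 < i) (hi : i < N) :
    f i = f 1 := by
  induction i, h0 using Nat.le_induction with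
  | base => rfl
  | succ i hi0 ih => rw [h i hi0 hi, ih (by omega)]

theorem eq_innerLine (hN : 1 < N) {A : Type} {z : A} {f : ℕ → A}
    (h : ∀ i < N, InnerRule z (side N i) (f i) (f (i + 1))) {i : ℕ} (hi : i ≤ N) :
    f i = innerLine N z (f 1) i := by
  unfold innerLine
  split_ifs with h'
  · rcases h' with rfl | rfl
    · have := h 0 (by omega)
      rwa [side_eq_first.2 rfl] at this
    · have := h (i - 1) (by omega)
      rw [(side_eq_last hN).2 (by omega), show i - 1 + 1 = i by omega] at this
      exact this
  · refine eq_of_straight (N := N) (fun i h0 hi => ?_) (by omega) (by omega)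
    have := h i (by omega)
    rwa [side_eq_mid h0 hi] at this

theorem innerValue_eq (hN : 1 < N) {A : Type} {z : A} {f : ℕ → A}
    (h : ∀ i < N, InnerRule z (side N i) (f i) (f (i + 1))) {i : ℕ} (hi : i < N) :
    innerValue (side N i) (f i) (f (i + 1)) = f 1 := by
  rw [eq_innerLine hN h hi.le, eq_innerLine hN h (i := i + 1) hi, innerValue_innerLine hN _ _ hi]

theorem eq_outerLine (hN : 2 < N) {f : ℕ → Bool × Bool}
    (h : ∀ i < N, OuterRule (side N i) (f i) (f (i + 1))) {i : ℕ} (hi : i ≤ N) :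
    f i = outerLine N (f 1) i := by
  have hmid : ∀ i, 0 < i → i < N → f i = f 1 := fun i h0 hi =>
    eq_of_straight (N := N) (fun i h0 hi => by
      have := h i (by omega)
      rwa [side_eq_mid h0 hi] at this) h0 hi
  unfold outerLine
  by_cases h0 : i = 0
  · subst h0
    have := h 0 (by omega)
    rw [side_eq_first.2 rfl] at this
    rw [if_neg (by omega), if_pos rfl]
    exact Prod.ext this.2.symm (this.1.symm.trans this.2.symm)
  by_cases h1 : i = N
  · subst h1
    have := h (i - 1) (by omega)
    rw [(side_eq_last (by omega)).2 (by omega), show i - 1 + 1 = i by omega,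
      hmid (i - 1) (by omega) (by omega)] at this
    rw [if_pos rfl, if_neg h0]
    exact Prod.ext (this.2.trans this.1) this.1
  · rw [if_neg h0, if_neg h1, hmid i (by omega) (by omega)]

/-- The marks of the lines of one direction, up to the last crossing line, together with the states
of the scanner on this line. -/
theorem exists_mark_line (hN : 1 < N) {A B : ℕ → ℕ → Label}
    (hA : ∀ i < N, ∀ j < N, MarkRule (side N i) (side N j) (A i j) (A (i + 1) j) (B i j))
    (hB : ∀ i < N, ∀ j < N, MarkRule (side N j) (side N i) (B i j) (B i (j + 1)) (A i j)) :
    ∃ I < N, (∀ i < N, ∀ j < N, (A i j).mark = decide (j = I)) ∧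
      ∀ j, 0 < j → j ≤ N → (B (N - 1) j).state = scan N I j := by
  have hlast : side N (N - 1) = .last := (side_eq_last hN).2 (by omega)
  have hstraight : ∀ i < N, ∀ j < N, (A i j).mark = (A 0 j).mark := by
    intro i hi j hj
    induction i with
    | zero => rfl
    | succ i ih =>
      rw [(hA i (by omega) j hj).straight (by rw [Ne, side_eq_last hN]; omega), ih (by omega)]
  obtain ⟨I, hI, h1, h2⟩ := exists_mark (N := N) (w := fun j => (A (N - 1) j).mark)
    (s := fun j => (B (N - 1) j).state)
    (fun j hj => by
      simpa [side_eq_first] using (hB (N - 1) (by omega) j hj).run hlast)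
    (fun j hj h0 => (hB (N - 1) (by omega) j hj).once hlast (by rwa [Ne, side_eq_first]))
    (by omega)
    (by
      have := (hB (N - 1) (by omega) (N - 1) (by omega)).found hlast hlast
      rwa [show N - 1 + 1 = N by omega] at this)
  refine ⟨I, hI, fun i hi j hj => ?_, h2⟩
  rw [hstraight i hi j hj, ← hstraight (N - 1) (by omega) j hj]
  exact h1 j hj

/-- The marks and the states on the boundary of the macro-tile are determined as well
if the neighboring macro-tiles are correct. -/
theorem mark_eq_markLine (hN : 1 < N) {A B : ℕ → ℕ → Label}
    (hA : ∀ i < N, ∀ j < N, MarkRule (side N i) (side N j) (A i j) (A (i + 1) j) (B i j))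
    (hB : ∀ i < N, ∀ j < N, MarkRule (side N j) (side N i) (B i j) (B i (j + 1)) (A i j))
    {I : ℕ} (hI : I < N) (hmark : ∀ i < N, ∀ j < N, (A i j).mark = decide (j = I))
    (hstate : ∀ j, 0 < j → j ≤ N → (B (N - 1) j).state = scan N I j)
    (hnext : ∃ I' < N, ∀ j < N, (A N j).mark = decide (j = I'))
    (hprev : (B (N - 1) 0).state ≠ 0) :
    (∀ i ≤ N, ∀ j < N, (A i j).mark = markLine N I i j) ∧
      ∀ i < N, ∀ j ≤ N, (B i j).state = stateLine N I j i := by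
  have hlast : side N (N - 1) = .last := (side_eq_last hN).2 (by omega)
  obtain ⟨I', hIN, hI'⟩ := hnext
  have hshift : ∀ j < N, (A N j).mark = decide ((B (N - 1) j).state = 1) := by
    intro j hj
    have := (hA (N - 1) (by omega) j hj).shift hlast
    rwa [show N - 1 + 1 = N by omega] at this
  have hinner : ∀ j, 0 < j → j < N → (A N j).mark = decide (j = I + 1) := by
    intro j h0 hj
    rw [hshift j hj, hstate j h0 hj.le, decide_eq_decide, scan]
    split_ifs <;> simp <;> omega
  -- The rules inside the block leave the border state free. It is pinned down by the next block,
  -- which has exactly one mark: that mark is in place 0 exactly when it is in none of the places 1,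
  -- ..., N - 1.
  have hzero : (A N 0).mark = true ↔ I + 1 = N := by
    rw [hI' 0 (by omega), decide_eq_true_eq]
    constructor
    · intro h
      by_contra hc
      have h1 := hinner (I + 1) (by omega) (by omega)
      rw [hI' _ (by omega)] at h1
      simp at h1
      omega
    · intro h
      by_contra hc
      have h1 := hinner I' (by omega) hIN
      rw [hI' _ hIN] at h1
      simp at h1
      omega
  refine ⟨fun i hi j hj => ?_, fun i hi j hj => ?_⟩
  · by_cases h : i = N
    · subst h
      rw [markLine, if_pos rfl]
      by_cases h0 : j = 0
      · subst h0
        rw [Bool.eq_iff_iff, hzero, decide_eq_true_eq]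
        rcases (by omega : I + 1 = i ∨ I + 1 < i) with h1 | h1
        · simp [h1]
        · rw [Nat.mod_eq_of_lt h1]; omega
      · rw [hinner j (by omega) hj, decide_eq_decide]
        rcases (by omega : I + 1 = i ∨ I + 1 < i) with h1 | h1
        · rw [h1, Nat.mod_self]; omega
        · rw [Nat.mod_eq_of_lt h1]
    · rw [hmark i (by omega) j hj, markLine, if_neg h]
  · unfold stateLine
    split_ifs with h
    · obtain rfl : i = N - 1 := by omega
      by_cases h0 : j = 0
      · subst h0
        rw [hshift 0 (by omega), decide_eq_true_eq] at hzero
        rw [scan, if_pos rfl]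
        split_ifs with h1
        · exact hzero.2 h1
        -- Only three states exist, and 0 is excluded by the preceding block, so the state is 2.
        · have h2 : (B (N - 1) 0).state ≠ 1 := fun hc => h1 (hzero.1 hc)
          generalize (B (N - 1) 0).state = x at hprev h2
          clear * - hprev h2
          revert x
          decide
      · exact hstate j (by omega) hj
    · have hi' : side N i ≠ .last := by rwa [Ne, side_eq_last hN]
      by_cases h1 : j = N
      · have := ((hB i hi (N - 1) (by omega)).idle hi').2
        rwa [show N - 1 + 1 = j by omega] at this
      · exact ((hB i hi j (by omega)).idle hi').1

end LineUniqueness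

section Uniqueness

variable {N I J : ℕ} {H V : ℕ → ℕ → Label}

/-- A row carries one symbol throughout its interior, which `symOn` fixes at the crossing in column
J and `symOff` erases on unmarked rows. -/
theorem hSym_eq (hN : 1 < N) (hI : I < N) (hJ : J < N)
    (hR : ∀ i < N, ∀ j < N, Rule (kindPair N i j) (H i j) (H (i + 1) j) (V i j) (V i (j + 1)))
    (hH : ∀ i < N, ∀ j < N, (H i j).mark = decide (j = I))
    (hV : ∀ i < N, ∀ j < N, (V i j).mark = decide (i = J)) {i j : ℕ} (hi : i ≤ N) (hj : j < N) :
    (H i j).sym = if j = I then innerLine N none (some (kindPair N I J)) i else none := by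
  have hline : ∀ i < N, InnerRule none (side N i) (H i j).sym (H (i + 1) j).sym :=
    fun i hi => (hR i hi j hj).symH
  rw [eq_innerLine hN (f := fun i => (H i j).sym) hline hi]
  split_ifs with h
  · subst h
    congr 1
    rw [← innerValue_eq hN (f := fun i => (H i j).sym) hline hJ]
    exact (hR J hJ j hj).symOn (by simp [hH J hJ j hj]) (by simp [hV J hJ j hj])
  · have := (hR 0 (by omega) j hj).symOff (by simpa [hH 0 (by omega) j hj] using h)
    have h1 := innerValue_eq hN (f := fun i => (H i j).sym) hline (i := 0) (by omega)
    rw [← h1]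
    simp only [kindPair, kind] at this
    rw [this]
    simp [innerLine]

/-- The bus reads its symbol where it crosses the marked row I and holds it along its whole
interior. -/
theorem vSym_eq (hN : LargeEnough N) (hI : I < N) (hJ : J < N)
    (hR : ∀ i < N, ∀ j < N, Rule (kindPair N i j) (H i j) (H (i + 1) j) (V i j) (V i (j + 1)))
    (hH : ∀ i < N, ∀ j < N, (H i j).mark = decide (j = I))
    (hV : ∀ i < N, ∀ j < N, (V i j).mark = decide (i = J)) {i j : ℕ} (hi : i < N) (hj : j ≤ N) :
    (V i j).sym = if i = place (Sum.inl () : ColIdx) then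
      innerLine N none (some (kindPair N I J)) j else none := by
  have h1 := hN.one_lt
  split_ifs with h
  · have hbus : ∀ j, (kindPair N i j).1.colUse = .bus := fun _ => colUse_eq_bus.2 h
    have hline : ∀ j < N, InnerRule none (side N j) (V i j).sym (V i (j + 1)).sym :=
      fun j hj => (hR i hi j hj).symV (hbus j)
    rw [eq_innerLine h1 (f := fun j => (V i j).sym) hline hj]
    congr 1
    rw [← innerValue_eq h1 (f := fun j => (V i j).sym) hline hI]
    refine ((hR i hi I hI).symRead (hbus I) (by simp [hH i hi I hI])).trans ?_
    rw [hSym_eq h1 hI hJ hR hH hV hi.le hI, if_pos rfl, innerLine, if_neg]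
    have := place_pos (Sum.inl () : ColIdx)
    omega
  · have hidle : ∀ j, (kindPair N i j).1.colUse ≠ .bus := fun _ hc => h (colUse_eq_bus.1 hc)
    by_cases hjN : j = N
    · have := ((hR i hi (N - 1) (by omega)).symIdle (hidle _)).2
      rwa [show N - 1 + 1 = j by omega] at this
    · exact ((hR i hi j (by omega)).symIdle (hidle _)).1

/-- The pair next to the first cell determines its row, because pairs are constant in the interior
and the ends are functions of that value. -/
theorem hPair_eq (hN : LargeEnough N)
    (hR : ∀ i < N, ∀ j < N, Rule (kindPair N i j) (H i j) (H (i + 1) j) (V i j) (V i (j + 1)))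
    {i j : ℕ} (hi : i ≤ N) (hj : j < N) :
    (H i j).pair = rowPair N (fun k => (H 1 (place k)).pair) i (unplace DataIdx j) := by
  have h2 : 2 < N := by unfold LargeEnough at hN; omega
  rcases hu : unplace DataIdx j with _ | s | s
  · have hidle : ∀ i, (kindPair N i j).1.rowUse = .idle := fun i => by
      simp [kindPair, kind, hu, rowUse]
    by_cases hiN : i = N
    · have := ((hR (N - 1) (by omega) j hj).rowIdle (hidle _)).2
      rwa [show N - 1 + 1 = i by omega] at this
    · exact ((hR i (by omega) j hj).rowIdle (hidle _)).1
  · have hp := unplace_eq_some.1 hu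
    simp only [rowPair, ← hp]
    exact eq_outerLine h2 (f := fun i => (H i j).pair)
      (fun i hi => (hR i hi j hj).rowOuter (by simp [kindPair, kind, hu, rowUse])) hi
  · have hp := unplace_eq_some.1 hu
    simp only [rowPair, ← hp]
    exact eq_innerLine (by omega) (f := fun i => (H i j).pair)
      (fun i hi => (hR i hi j hj).rowInner (by simp [kindPair, kind, hu, rowUse])) hi

/-- All column pairs are functions of the data rows: outer columns copy theirs at a `turn` gate, and
clause columns accumulate the mismatches met so far. No admissibility of the data is needed. -/
theorem vPair_eq (hN : LargeEnough N)
    (hR : ∀ i < N, ∀ j < N, Rule (kindPair N i j) (H i j) (H (i + 1) j) (V i j) (V i (j + 1)))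
    {i j : ℕ} (hi : i < N) (hj : j ≤ N) :
    (V i j).pair = colPair N (fun k => (H 1 (place k)).pair) j (unplace ColIdx i) := by
  have h2 : 2 < N := by unfold LargeEnough at hN; omega
  have idle : (∀ j, (kindPair N i j).1.colUse = .idle ∨ (kindPair N i j).1.colUse = .bus) →
      (V i j).pair = (false, false) := by
    intro hidle
    by_cases hjN : j = N
    · have := ((hR i hi (N - 1) (by omega)).colIdle (hidle _)).2
      rwa [show N - 1 + 1 = j by omega] at this
    · exact ((hR i hi j (by omega)).colIdle (hidle _)).1
  rcases hu : unplace ColIdx i with _ | s | s | α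
  · exact idle fun j => by simp [kindPair, kind, hu, colUse]
  · exact idle fun j => by simp [kindPair, kind, hu, colUse]
  · have hline : ∀ j < N, OuterRule (side N j) (V i j).pair (V i (j + 1)).pair := fun j hj =>
      (hR i hi j hj).colOuter (by simp [kindPair, kind, hu, colUse])
    rw [eq_outerLine h2 (f := fun j => (V i j).pair) hline hj]
    simp only [colPair]
    congr 1
    have hlt := hN.row_lt (.inr (.inl s))
    have hpos := place_pos (A := DataIdx) (.inr (.inl s))
    have hturn := (hR i hi (place (A := DataIdx) (.inr (.inl s))) (by omega)).turn
      (by simp [kindPair, kind, hu, unplace_place, gate])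
    rw [hPair_eq hN hR hi.le (by omega), unplace_place,
      rowPair_inner _ _ ((unplace_eq_some.1 hu) ▸ place_pos _) hi,
      eq_outerLine h2 (f := fun j => (V i j).pair) hline (by omega), outerLine,
      if_neg (by omega), if_neg (by omega)] at hturn
    exact hturn.symm
  · by_cases hα : Allowed α
    · simp only [colPair, if_pos hα]
      exact idle fun j => by simp [kindPair, kind, hu, colUse, hα]
    simp only [colPair, if_neg hα]
    have hclause : ∀ j < N, ClauseRule (side N j) (gate (unplace ColIdx i) (unplace DataIdx j))
        (H i j).pair (V i j).pair (V i (j + 1)).pair := fun j hj =>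
      (hR i hi j hj).colClause (by simp [kindPair, kind, hu, colUse, hα])
    have hi0 : 0 < i := (unplace_eq_some.1 hu) ▸ place_pos _
    refine Prod.ext ?_ ?_
    · by_cases hjN : j = N
      · have := ((hclause (N - 1) (by omega)).found ((side_eq_last (by omega)).2 (by omega))).2
        rw [show N - 1 + 1 = j by omega] at this
        rw [this, eq_comm, decide_eq_false_iff_not]
        omega
      replace hj : j < N := by omega
      clear hjN idle
      induction j with
      | zero => simpa using (hclause 0 hj).init (side_eq_first.2 rfl)
      | succ j ih =>
        have hrun := (hclause j (by omega)).run
          (by rw [Ne, side_eq_last hN.one_lt]; omega)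
        rw [hrun, ih (by omega), hu]
        rcases hk : unplace DataIdx j with _ | k
        · simp only [gate, mismatch, Bool.or_false, decide_eq_decide]
          constructor
          · rintro ⟨-, k, hk', h'⟩
            exact ⟨hj, k, by omega, h'⟩
          · rintro ⟨-, k, hk', h'⟩
            refine ⟨by omega, k, ?_, h'⟩
            rcases (by omega : place k < j ∨ place k = j) with h3 | h3
            · exact h3
            · rw [← h3, unplace_place] at hk
              cases hk
        · rw [hPair_eq hN hR hi.le (by omega), hk, rowPair_inner _ _ hi0 hi]
          simp only [gate, mismatch]
          rw [← Bool.decide_or, decide_eq_decide]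
          have hk' := unplace_eq_some.1 hk
          constructor
          · rintro (⟨-, k', h3, h'⟩ | h')
            · exact ⟨hj, k', by omega, h'⟩
            · exact ⟨hj, k, by omega, h'⟩
          · rintro ⟨-, k', h3, h'⟩
            rcases (by omega : place k' < j ∨ place k' = j) with h4 | h4
            · exact Or.inl ⟨by omega, k', h4, h'⟩
            · rw [← h4, unplace_place] at hk
              cases hk
              exact Or.inr h'
    · by_cases hjN : j = N
      · have := (hclause (N - 1) (by omega)).snd.2
        rwa [show N - 1 + 1 = j by omega] at this
      · exact (hclause j (by omega)).snd.1

/-- The pairs of bits in the data rows encode labels that satisfy the rule. -/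
theorem exists_data (hN : LargeEnough N) (hI : I < N) (hJ : J < N)
    (hR : ∀ i < N, ∀ j < N, Rule (kindPair N i j) (H i j) (H (i + 1) j) (V i j) (V i (j + 1)))
    (hH : ∀ i < N, ∀ j < N, (H i j).mark = decide (j = I))
    (hV : ∀ i < N, ∀ j < N, (V i j).mark = decide (i = J)) :
    ∃ l r d u, Rule (kindPair N I J) l r d u ∧
      (fun k : DataIdx => (H 1 (place k)).pair) = dataOf (kindPair N I J) l r d u := by
  have h1 := hN.one_lt
  -- Were the data forbidden, they would have a clause column of their own, which could never find a
  -- mismatch.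
  have hA : Allowed fun k => (H 1 (place k)).pair := by
    by_contra hα
    set α : DataIdx → Bool × Bool := fun k => (H 1 (place k)).pair with hαdef
    set i := place (Sum.inr (Sum.inr α) : ColIdx) with hidef
    have hi : i < N := by have := hN.col_lt (Sum.inr (Sum.inr α)); omega
    have hc := (hR i hi (N - 1) (by omega)).colClause
      (by simp [kindPair, kind, hidef, unplace_place, colUse, hα])
    have := (hc.found ((side_eq_last h1).2 (by omega))).1
    rw [vPair_eq hN hR hi (by omega), hidef, unplace_place] at this
    simp only [colPair, if_neg hα, decide_eq_true_eq] at this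
    obtain ⟨-, k, -, hk⟩ := this
    exact hk rfl
  obtain ⟨k, l, r, d, u, hrule, hdata⟩ := hA
  -- The data encode some kind pair. The `emit` gates force its code bits to be those on the bus,
  -- and `kindCode` is injective.
  have hk : k = kindPair N I J := by
    refine kindCode.injective (funext fun s => ?_)
    have h3 := congrFun hdata (.inr (.inr s))
    set i := place (Sum.inl () : ColIdx) with hidef
    have hi : i < N := by have := hN.col_lt (Sum.inl ()); omega
    have hlt := hN.row_lt (.inr (.inr s))
    have hpos := place_pos (A := DataIdx) (.inr (.inr s))
    obtain ⟨g, hg, hp⟩ := (hR i hi (place (A := DataIdx) (.inr (.inr s))) (by omega)).emit s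
      (by simp [kindPair, kind, hidef, unplace_place, gate])
    rw [vSym_eq hN hI hJ hR hH hV hi (by omega), if_pos rfl, innerLine, if_neg (by omega),
      Option.some_inj] at hg
    rw [hPair_eq hN hR hi.le (by omega), unplace_place, rowPair_inner _ _ (place_pos _) hi] at hp
    rw [hg]
    exact congrArg Prod.fst (h3.trans hp)
  subst hk
  exact ⟨l, r, d, u, hrule, hdata.symm⟩

end Uniqueness

/-! ### The tile set -/

/-- Edges carry a coordinate modulo `N`, a bit that keeps the other coordinate
coherent, and a label. -/
abbrev Color (N : ℕ) : Type := ZMod N × Bool × Label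

/-- The tile in column `i` and row `j` with given labels on the left, right, bottom and top side. -/
def cell (N i j : ℕ) (l r d u : Label) : Tile (Color N) where
  left := ((i : ZMod N), decide (j + 1 = N), l)
  right := ((i : ZMod N) + 1, decide (j + 1 = N), r)
  top := ((j : ZMod N) + 1, decide (i + 1 = N), u)
  bottom := ((j : ZMod N), decide (i + 1 = N), d)

/-- The self-similar tile set with zoom factor `N`. -/
def tileSet (N : ℕ) : Set (Tile (Color N)) :=
  {t | ∃ i < N, ∃ j < N, ∃ l r d u, Rule (kindPair N i j) l r d u ∧ t = cell N i j l r d u}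

/-- The macro-tile that represents a tile. -/
noncomputable def macroTile (N : ℕ) (t : Tile (Color N)) : Square (Color N) N := fun i j =>
  let I := t.left.1.val
  let J := t.bottom.1.val
  let D := dataOf (kindPair N I J) t.left.2.2 t.right.2.2 t.bottom.2.2 t.top.2.2
  cell N i j (hLabel N I J D i j) (hLabel N I J D (i + 1) j)
    (vLabel N I J D i j) (vLabel N I J D i (j + 1))

theorem macroTile_cell {N I J : ℕ} (hI : I < N) (hJ : J < N) (l r d u : Label) (i j : Fin N)
    {D : DataIdx → Bool × Bool} (hD : D = dataOf (kindPair N I J) l r d u) :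
    macroTile N (cell N I J l r d u) i j =
      cell N i j (hLabel N I J D i j) (hLabel N I J D (i + 1) j)
        (vLabel N I J D i j) (vLabel N I J D i (j + 1)) := by
  simp only [macroTile, cell, ZMod.val_natCast_of_lt hI, ZMod.val_natCast_of_lt hJ, hD]

/-! ### Macro-colors -/

/-- The macro-color that represents a color; the line number `j` carries the bit "the label
is `s`" if `f j = some s`. -/
def sideCode (N : ℕ) (f : ℕ → Option Label) (c : Color N) : Fin N → Color N := fun j =>
  (0, decide ((j : ℕ) + 1 = N),
    { mark := decide ((j : ℕ) = c.1.val)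
      state := if (j : ℕ) + 1 = N then (if c.2.1 then 1 else 2) else 0
      pair := match f j with
        | some s => (decide (c.2.2 = s), decide (c.2.2 = s))
        | none => (false, false)
      sym := none })

/-- The mark gives the coordinate, the state on the last line the bit, and the row or column of each
label tells whether that label is the encoded one. -/
theorem sideCode_injective {N : ℕ} [NeZero N] {f : ℕ → Option Label}
    (hf : ∀ s, ∃ j < N, f j = some s) : Function.Injective (sideCode N f) := by
  rintro ⟨a, e, x⟩ ⟨a', e', x'⟩ h
  have hN : 0 < N := Nat.pos_of_ne_zero (NeZero.ne N)
  have h1 := congrArg (fun c : Color N => c.2.2.mark) (congrFun h ⟨a.val, ZMod.val_lt a⟩)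
  have h2 := congrArg (fun c : Color N => c.2.2.state) (congrFun h ⟨N - 1, by omega⟩)
  obtain ⟨j, hj, hjx⟩ := hf x
  have h3 := congrArg (fun c : Color N => c.2.2.pair.1) (congrFun h ⟨j, hj⟩)
  simp only [sideCode, hjx, decide_true, eq_comm (a := true), decide_eq_true_eq] at h1 h3
  simp only [sideCode, show N - 1 + 1 = N by omega, if_true] at h2
  have h4 : e = e' := by cases e <;> cases e' <;> simp_all
  rw [ZMod.val_injective N h1, h4, h3]

/-- The label whose bits are carried by a row. -/
noncomputable def rowLabel (j : ℕ) : Option Label :=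
  match unplace DataIdx j with
  | some (.inl s) => some s
  | _ => none

/-- The label whose bits are carried by a column. -/
noncomputable def colLabel (i : ℕ) : Option Label :=
  match unplace ColIdx i with
  | some (.inr (.inl s)) => some s
  | _ => none

theorem exists_rowLabel {N : ℕ} (hN : LargeEnough N) (s : Label) :
    ∃ j < N, rowLabel j = some s :=
  ⟨place (Sum.inl s : DataIdx), by have := hN.row_lt (Sum.inl s); omega, by
    simp [rowLabel, unplace_place]⟩

theorem exists_colLabel {N : ℕ} (hN : LargeEnough N) (s : Label) :
    ∃ j < N, colLabel j = some s :=
  ⟨place (Sum.inr (Sum.inl s) : ColIdx),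
    by have := hN.col_lt (Sum.inr (Sum.inl s)); omega, by simp [colLabel, unplace_place]⟩

section Sides

variable {N I J : ℕ} (hN : LargeEnough N) (hI : I < N) (hJ : J < N) (l r d u : Label)

include hN hI hJ

theorem leftColor_macroTile :
    (macroTile N (cell N I J l r d u)).leftColor hN.one_lt =
      sideCode N rowLabel (cell N I J l r d u).left := by
  funext j
  have h0 : ¬ 0 = N := by have := hN.one_lt; omega
  rw [Square.leftColor, macroTile_cell hI hJ l r d u _ _ rfl]
  simp only [sideCode, cell,
    ZMod.val_natCast_of_lt hI, Nat.cast_zero, hLabel, markLine, stateLine, scan, if_neg h0,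
    decide_eq_true_eq, innerLine]
  congr 3
  · rcases hu : unplace DataIdx j with _ | s | s <;>
      simp [rowLabel, hu, rowPair, outerLine, innerLine, dataOf, h0]
    exact decide_eq_decide.2 Iff.rfl
  · simp

theorem rightColor_macroTile :
    (macroTile N (cell N I J l r d u)).rightColor hN.one_lt =
      sideCode N rowLabel (cell N I J l r d u).right := by
  funext j
  have h1 := hN.one_lt
  have h0 : ¬ N = 0 := by omega
  have hs : scan N J N = if J + 1 = N then 1 else 2 := by
    unfold scan
    rw [if_neg h0, if_neg (by omega)]
    simp only [eq_comm]
  -- Addition modulo N matches the mark that moves up by one row and wraps around in the last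
  -- column.
  have hv : ((I : ZMod N) + 1).val = (I + 1) % N := by
    rw [← ZMod.val_natCast]; push_cast; rfl
  have hc : ((N - 1 : ℕ) : ZMod N) + 1 = 0 := by
    rw [Nat.cast_sub h1.le]; simp
  rw [Square.rightColor, macroTile_cell hI hJ l r d u _ _ rfl]
  simp only [sideCode, cell,
    hLabel, markLine, stateLine, show N - 1 + 1 = N by omega, if_true, hs, hv, hc,
    decide_eq_true_eq, innerLine]
  congr 3
  · rcases hu : unplace DataIdx j with _ | s | s <;>
      simp [rowLabel, hu, rowPair, outerLine, innerLine, dataOf, h0]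
    exact decide_eq_decide.2 Iff.rfl
  · simp

theorem bottomColor_macroTile :
    (macroTile N (cell N I J l r d u)).bottomColor hN.one_lt =
      sideCode N colLabel (cell N I J l r d u).bottom := by
  funext i
  have h0 : ¬ 0 = N := by have := hN.one_lt; omega
  rw [Square.bottomColor, macroTile_cell hI hJ l r d u _ _ rfl]
  simp only [sideCode, cell,
    ZMod.val_natCast_of_lt hJ, Nat.cast_zero, vLabel, markLine, stateLine, scan, if_neg h0,
    decide_eq_true_eq, innerLine]
  congr 3
  · rcases hu : unplace ColIdx i with _ | s | s | α <;>
      simp [colLabel, hu, colPair, outerLine, dataOf, h0]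
    exact decide_eq_decide.2 Iff.rfl
  · simp

theorem topColor_macroTile :
    (macroTile N (cell N I J l r d u)).topColor hN.one_lt =
      sideCode N colLabel (cell N I J l r d u).top := by
  funext i
  have h1 := hN.one_lt
  have h0 : ¬ N = 0 := by omega
  have hs : scan N I N = if I + 1 = N then 1 else 2 := by
    unfold scan
    rw [if_neg h0, if_neg (by omega)]
    simp only [eq_comm]
  have hv : ((J : ZMod N) + 1).val = (J + 1) % N := by
    rw [← ZMod.val_natCast]; push_cast; rfl
  have hc : ((N - 1 : ℕ) : ZMod N) + 1 = 0 := by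
    rw [Nat.cast_sub h1.le]; simp
  rw [Square.topColor, macroTile_cell hI hJ l r d u _ _ rfl]
  simp only [sideCode, cell,
    vLabel, markLine, stateLine, show N - 1 + 1 = N by omega, if_true, hs, hv, hc,
    decide_eq_true_eq, innerLine]
  congr 3
  · rcases hu : unplace ColIdx i with _ | s | s | α <;>
      simp [colLabel, hu, colPair, outerLine, dataOf, h0]
    exact decide_eq_decide.2 Iff.rfl
  · simp

end Sides

/-! ### The isomorphism with macro-tiles, and a self-reproducing blank cell. -/

section TileSet

variable {N : ℕ} (hN : LargeEnough N)

include hN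

theorem toTile_macroTile {t : Tile (Color N)} (ht : t ∈ tileSet N) :
    (macroTile N t).toTile hN.one_lt = ⟨sideCode N rowLabel t.left, sideCode N rowLabel t.right,
      sideCode N colLabel t.top, sideCode N colLabel t.bottom⟩ := by
  obtain ⟨i, hi, j, hj, l, r, d, u, -, rfl⟩ := ht
  simp only [Square.toTile, leftColor_macroTile hN hi hj, rightColor_macroTile hN hi hj,
    topColor_macroTile hN hi hj, bottomColor_macroTile hN hi hj]

theorem macroTile_hMatch {s t : Tile (Color N)} (hs : s ∈ tileSet N) (ht : t ∈ tileSet N) :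
    s.HMatch t ↔
      ((macroTile N s).toTile hN.one_lt).HMatch ((macroTile N t).toTile hN.one_lt) := by
  have : NeZero N := ⟨by have := hN.one_lt; omega⟩
  rw [toTile_macroTile hN hs, toTile_macroTile hN ht]
  exact (sideCode_injective (exists_rowLabel hN)).eq_iff.symm

theorem macroTile_vMatch {s t : Tile (Color N)} (hs : s ∈ tileSet N) (ht : t ∈ tileSet N) :
    s.VMatch t ↔
      ((macroTile N s).toTile hN.one_lt).VMatch ((macroTile N t).toTile hN.one_lt) := by
  have : NeZero N := ⟨by have := hN.one_lt; omega⟩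
  rw [toTile_macroTile hN hs, toTile_macroTile hN ht]
  exact (sideCode_injective (exists_colLabel hN)).eq_iff.symm

theorem macroTile_injOn : Set.InjOn (macroTile N) (tileSet N) := by
  intro s hs t ht h
  have : NeZero N := ⟨by have := hN.one_lt; omega⟩
  have h' := congrArg (fun M : Square (Color N) N => M.toTile hN.one_lt) h
  simp only [toTile_macroTile hN hs, toTile_macroTile hN ht, Tile.mk.injEq] at h'
  exact Tile.ext (sideCode_injective (exists_rowLabel hN) h'.1)
    (sideCode_injective (exists_rowLabel hN) h'.2.1)
    (sideCode_injective (exists_colLabel hN) h'.2.2.1)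
    (sideCode_injective (exists_colLabel hN) h'.2.2.2)

theorem isMacroTile_macroTile {t : Tile (Color N)} (ht : t ∈ tileSet N) :
    IsMacroTile (tileSet N) (macroTile N t) := by
  obtain ⟨I, hI, J, hJ, l, r, d, u, hR, rfl⟩ := ht
  refine ⟨fun i j => ?_, fun i i' j h => ?_, fun i j j' h => ?_⟩
  · rw [macroTile_cell hI hJ l r d u _ _ rfl]
    exact ⟨i, i.2, j, j.2, _, _, _, _, rule_labels hN hI hJ hR rfl i.2 j.2, rfl⟩
  · rw [macroTile_cell hI hJ l r d u _ _ rfl, macroTile_cell hI hJ l r d u _ _ rfl]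
    simp only [Tile.HMatch, cell, ← h, Nat.cast_add, Nat.cast_one]
  · rw [macroTile_cell hI hJ l r d u _ _ rfl, macroTile_cell hI hJ l r d u _ _ rfl]
    simp only [Tile.VMatch, cell, ← h, Nat.cast_add, Nat.cast_one]

/-- The label without any information. -/
def blank : Label := ⟨false, 0, (false, false), none⟩

/-- The summand 5 in `LargeEnough` keeps the last four lines in each direction free of the layout.
-/
theorem unplace_row_eq_none {j : ℕ} (hj : N ≤ j + 4) : unplace DataIdx j = none :=
  unplace_eq_none (Or.inr (by unfold LargeEnough at hN; omega))

theorem unplace_col_eq_none {i : ℕ} (hi : N ≤ i + 4) : unplace ColIdx i = none :=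
  unplace_eq_none (Or.inr (by unfold LargeEnough at hN; omega))

theorem cell_blank_mem :
    cell N (N - 2) (N - 3) blank blank blank blank ∈ tileSet N := by
  have h5 : 5 ≤ N := by unfold LargeEnough at hN; omega
  refine ⟨N - 2, by omega, N - 3, by omega, _, _, _, _, ?_, rfl⟩
  have hc : side N (N - 2) = .mid := side_eq_mid (by omega) (by omega)
  have hr : side N (N - 3) = .mid := side_eq_mid (by omega) (by omega)
  have h1 := unplace_row_eq_none hN (j := N - 3) (by omega)
  have h2 := unplace_col_eq_none hN (i := N - 2) (by omega)
  constructor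
  case markH => constructor <;> simp [kindPair, kind, hc, hr, blank]
  case markV => constructor <;> simp [kindPair, kind, hc, hr, blank]
  all_goals simp [kindPair, kind, hc, h1, h2, blank, InnerRule, innerValue,
    rowUse, colUse, gate]

/-- The coordinates differ on purpose: the marks run along row N - 2 and column N - 3, so they miss
the cell in column N - 2 and row N - 3, which stays blank. -/
theorem macroTile_cell_blank :
    macroTile N (cell N (N - 2) (N - 3) blank blank blank blank)
      ⟨N - 2, by have := hN.one_lt; omega⟩ ⟨N - 3, by have := hN.one_lt; omega⟩ =
    cell N (N - 2) (N - 3) blank blank blank blank := by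
  have h5 : 5 ≤ N := by unfold LargeEnough at hN; omega
  rw [macroTile_cell (by omega) (by omega) _ _ _ _ _ _ rfl]
  have h1 := unplace_row_eq_none hN (j := N - 3) (by omega)
  have h2 := unplace_col_eq_none hN (i := N - 2) (by omega)
  have h3 : N - 2 ≠ place (Sum.inl () : ColIdx) := by
    intro h
    rw [h, unplace_place] at h2
    cases h2
  have hH : ∀ D i, i < N → hLabel N (N - 2) (N - 3) D i (N - 3) = blank := by
    intro D i hi
    have e1 : ¬ i = N := by omega
    have e2 : ¬ N - 3 = N - 2 := by omega
    have e3 : ¬ N - 3 + 1 = N := by omega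
    simp [hLabel, markLine, stateLine, e1, e2, e3, h1, rowPair, blank]
  have hV : ∀ D j, j < N → vLabel N (N - 2) (N - 3) D (N - 2) j = blank := by
    intro D j hj
    have e1 : ¬ j = N := by omega
    have e2 : ¬ N - 2 = N - 3 := by omega
    have e3 : ¬ N - 2 + 1 = N := by omega
    simp [vLabel, markLine, stateLine, e1, e2, e3, h2, h3, colPair, blank]
  rw [hH _ _ (by dsimp; omega), hH _ _ (by dsimp; omega), hV _ _ (by dsimp; omega),
    hV _ _ (by dsimp; omega)]

theorem exists_isTiling_tileSet : ∃ U, IsTiling (tileSet N) U := by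
  have h5 : 5 ≤ N := by unfold LargeEnough at hN; omega
  exact exists_tiling_of_expansion hN.one_lt (M := macroTile N)
    (o := (⟨N - 2, by omega⟩, ⟨N - 3, by omega⟩))
    (fun t ht => isMacroTile_macroTile hN ht) (cell_blank_mem hN)
    (fun s hs t ht => (macroTile_hMatch hN hs ht).1)
    (fun s hs t ht => (macroTile_vMatch hN hs ht).1) (macroTile_cell_blank hN)
    (by constructor <;> dsimp <;> omega) (by constructor <;> dsimp <;> omega)

end TileSet

/-! ### Tilings are cut into macro-tiles -/

section Tilings

variable {N : ℕ} {U : ℤ × ℤ → Tile (Color N)}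

theorem eq_add_intCast {f : ℤ → ZMod N} (h : ∀ a, f (a + 1) = f a + 1) (a : ℤ) :
    f a = f 0 + a := by
  induction a with
  | zero => simp
  | succ n ih => rw [h, ih]; push_cast; ring
  | pred n ih =>
    have := h (-n - 1)
    rw [sub_add_cancel, ih] at this
    push_cast at this ⊢
    linear_combination -this

/-- A sequence of residues that increase by one is determined by the places of `-1`. -/
theorem eq_of_eq_neg_one_iff {f g : ℤ → ZMod N} [NeZero N] (hf : ∀ a, f (a + 1) = f a + 1)
    (hg : ∀ a, g (a + 1) = g a + 1) (h : ∀ a, f a = -1 ↔ g a = -1) : f 0 = g 0 := by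
  have h1 : f ((-1 - f 0).val : ℕ) = -1 := by
    rw [eq_add_intCast hf]
    simp
  have h2 := (h _).1 h1
  rw [eq_add_intCast hg] at h2
  simp at h2
  linear_combination -h2

theorem val_add_one_eq_iff (hN : 1 < N) [NeZero N] (a : ZMod N) : a.val + 1 = N ↔ a = -1 := by
  constructor
  · intro h
    have : ((a.val + 1 : ℕ) : ZMod N) = 0 := by rw [h]; simp
    rw [Nat.cast_add, ZMod.natCast_zmod_val, Nat.cast_one] at this
    exact eq_neg_of_add_eq_zero_left this
  · rintro rfl
    obtain ⟨n, rfl⟩ : ∃ n, N = n + 1 := ⟨N - 1, by omega⟩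
    rw [ZMod.val_neg_one]

/-- Right and top labels are taken from the neighbors, so that each edge of the tiling is named
once, as a left or a bottom side. -/
theorem IsTiling.eq_cell (hU : IsTiling (tileSet N) U) (p : ℤ × ℤ) :
    Rule (kindPair N (U p).left.1.val (U p).bottom.1.val) (U p).left.2.2
      (U (p + (1, 0))).left.2.2 (U p).bottom.2.2 (U (p + (0, 1))).bottom.2.2 ∧
    U p = cell N (U p).left.1.val (U p).bottom.1.val (U p).left.2.2
      (U (p + (1, 0))).left.2.2 (U p).bottom.2.2 (U (p + (0, 1))).bottom.2.2 := by
  obtain ⟨i, hi, j, hj, l, r, d, u, hR, hp⟩ := hU.1 p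
  have h1 := hU.2.1 p
  have h2 := hU.2.2 p
  unfold Tile.HMatch at h1
  unfold Tile.VMatch at h2
  rw [← h1, ← h2, hp]
  simp only [cell, ZMod.val_natCast_of_lt hi, ZMod.val_natCast_of_lt hj]
  exact ⟨hR, trivial⟩

/-- The left color carries only the horizontal coordinate, which grows along rows. Rows agree with
each other because the bit on horizontal edges transmits where this coordinate is -1. The vertical
coordinate is symmetric. -/
theorem IsTiling.coordinates (hN : 1 < N) (hU : IsTiling (tileSet N) U) (p : ℤ × ℤ) :
    (U p).left.1 = (U 0).left.1 + p.1 ∧ (U p).bottom.1 = (U 0).bottom.1 + p.2 := by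
  have : NeZero N := ⟨by omega⟩
  have hx : ∀ b a : ℤ, (U (a + 1, b)).left.1 = (U (a, b)).left.1 + 1 := by
    intro b a
    have h := hU.2.1 (a, b)
    unfold Tile.HMatch at h
    rw [(hU.eq_cell (a, b)).2] at h
    simp only [cell, Prod.mk_add_mk, add_zero] at h
    rw [← h]
    simp
  have hy : ∀ a b : ℤ, (U (a, b + 1)).bottom.1 = (U (a, b)).bottom.1 + 1 := by
    intro a b
    have h := hU.2.2 (a, b)
    unfold Tile.VMatch at h
    rw [(hU.eq_cell (a, b)).2] at h
    simp only [cell, Prod.mk_add_mk, add_zero] at h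
    rw [← h]
    simp
  have hxb : ∀ a b : ℤ, (U (a, b)).bottom.2.1 = decide ((U (a, b)).left.1 = -1) ∧
      (U (a, b)).top.2.1 = decide ((U (a, b)).left.1 = -1) := by
    intro a b
    have h := (hU.eq_cell (a, b)).2
    constructor
    · rw [congrArg Tile.bottom h]
      simp only [cell, val_add_one_eq_iff hN]
    · rw [congrArg Tile.top h]
      simp only [cell, val_add_one_eq_iff hN]
  have hyb : ∀ a b : ℤ, (U (a, b)).left.2.1 = decide ((U (a, b)).bottom.1 = -1) ∧
      (U (a, b)).right.2.1 = decide ((U (a, b)).bottom.1 = -1) := by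
    intro a b
    have h := (hU.eq_cell (a, b)).2
    constructor
    · rw [congrArg Tile.left h]
      simp only [cell, val_add_one_eq_iff hN]
    · rw [congrArg Tile.right h]
      simp only [cell, val_add_one_eq_iff hN]
  have hxs : ∀ b : ℤ, (U (0, b + 1)).left.1 = (U (0, b)).left.1 := by
    intro b
    refine eq_of_eq_neg_one_iff (f := fun a => (U (a, b + 1)).left.1)
      (g := fun a => (U (a, b)).left.1) (hx _) (hx _) fun a => ?_
    have h : (U (a, b)).top = (U (a, b + 1)).bottom := by simpa [Tile.VMatch] using hU.2.2 (a, b)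
    have h' := congrArg (fun c : Color N => c.2.1) h
    simp only [(hxb _ _).1, (hxb _ _).2, decide_eq_decide] at h'
    exact h'.symm
  have hys : ∀ a : ℤ, (U (a + 1, 0)).bottom.1 = (U (a, 0)).bottom.1 := by
    intro a
    refine eq_of_eq_neg_one_iff (f := fun b => (U (a + 1, b)).bottom.1)
      (g := fun b => (U (a, b)).bottom.1) (hy _) (hy _) fun b => ?_
    have h : (U (a, b)).right = (U (a + 1, b)).left := by simpa [Tile.HMatch] using hU.2.1 (a, b)
    have h' := congrArg (fun c : Color N => c.2.1) h
    simp only [(hyb _ _).1, (hyb _ _).2, decide_eq_decide] at h'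
    exact h'.symm
  have hx0 : ∀ b : ℤ, (U (0, b)).left.1 = (U (0, 0)).left.1 := by
    intro b
    induction b with
    | zero => rfl
    | succ n ih => rw [hxs, ih]
    | pred n ih => rw [← ih, ← hxs, sub_add_cancel]
  have hy0 : ∀ a : ℤ, (U (a, 0)).bottom.1 = (U (0, 0)).bottom.1 := by
    intro a
    induction a with
    | zero => rfl
    | succ n ih => rw [hys, ih]
    | pred n ih => rw [← ih, ← hys, sub_add_cancel]
  obtain ⟨a, b⟩ := p
  constructor
  · have := eq_add_intCast (f := fun a => (U (a, b)).left.1) (hx b) a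
    simp only [hx0] at this
    exact this
  · have := eq_add_intCast (f := fun b => (U (a, b)).bottom.1) (hy a) b
    simp only [hy0] at this
    exact this

/-- A block of labels whose neighbors are correct is the block of labels of a macro-tile. -/
theorem exists_labels_eq (hN : LargeEnough N) {H V : ℤ × ℤ → ℕ → ℕ → Label}
    (hR : ∀ z, ∀ i < N, ∀ j < N,
      Rule (kindPair N i j) (H z i j) (H z (i + 1) j) (V z i j) (V z i (j + 1)))
    (hHN : ∀ z j, H z N j = H (z + (1, 0)) 0 j) (hVN : ∀ z i, V z i N = V (z + (0, 1)) i 0)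
    (z : ℤ × ℤ) :
    ∃ I < N, ∃ J < N, ∃ l r d u, Rule (kindPair N I J) l r d u ∧
      (∀ i ≤ N, ∀ j < N, H z i j = hLabel N I J (dataOf (kindPair N I J) l r d u) i j) ∧
      ∀ i < N, ∀ j ≤ N, V z i j = vLabel N I J (dataOf (kindPair N I J) l r d u) i j := by
  have h1 := hN.one_lt
  have hA : ∀ z, ∀ i < N, ∀ j < N,
      MarkRule (side N i) (side N j) (H z i j) (H z (i + 1) j) (V z i j) :=
    fun z i hi j hj => (hR z i hi j hj).markH
  have hB : ∀ z, ∀ i < N, ∀ j < N,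
      MarkRule (side N j) (side N i) (V z i j) (V z i (j + 1)) (H z i j) :=
    fun z i hi j hj => (hR z i hi j hj).markV
  choose I hI hHm hVs using fun z => exists_mark_line h1 (hA z) (hB z)
  choose J hJ hVm hHs using fun z => exists_mark_line h1 (A := fun i j => V z j i)
    (B := fun i j => H z j i) (fun i hi j hj => hB z j hj i hi) (fun i hi j hj => hA z j hj i hi)
  have hscan : ∀ {K : ℕ}, K < N → scan N K N ≠ 0 := by
    intro K hK
    rw [scan, if_neg (by omega), if_neg (by omega)]
    split_ifs <;> simp
  -- The block on the right has a single mark, and the scanner of the block below ends in a nonzero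
  -- state; these are the two facts about neighbors that are needed.
  obtain ⟨hHmark, hVstate⟩ := mark_eq_markLine h1 (hA z) (hB z) (hI z) (hHm z) (hVs z)
    ⟨I (z + (1, 0)), hI _, fun j hj => by rw [hHN, hHm _ 0 (by omega) j hj]⟩
    (by
      have := hVs (z - (0, 1)) N (by omega) le_rfl
      rw [hVN, sub_add_cancel] at this
      rw [this]
      exact hscan (hI _))
  obtain ⟨hVmark, hHstate⟩ := mark_eq_markLine h1 (A := fun i j => V z j i)
    (B := fun i j => H z j i) (fun i hi j hj => hB z j hj i hi) (fun i hi j hj => hA z j hj i hi)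
    (hJ z) (hVm z) (hHs z)
    ⟨J (z + (0, 1)), hJ _, fun j hj => by rw [hVN]; exact hVm (z + (0, 1)) 0 (by omega) j hj⟩
    (by
      have := hHs (z - (1, 0)) N (by omega) le_rfl
      rw [hHN, sub_add_cancel] at this
      rw [this]
      exact hscan (hJ _))
  have hVm' : ∀ i < N, ∀ j < N, (V z i j).mark = decide (i = J z) :=
    fun i hi j hj => hVm z j hj i hi
  obtain ⟨l, r, d, u, hrule, hD⟩ := exists_data hN (hI z) (hJ z) (hR z) (hHm z) hVm'
  refine ⟨I z, hI z, J z, hJ z, l, r, d, u, hrule, fun i hi j hj => ?_, fun i hi j hj => ?_⟩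
  · rw [← hD]
    exact Label.ext (hHmark i hi j hj) (hHstate j hj i hi) (hPair_eq hN (hR z) hi hj)
      (hSym_eq h1 (hI z) (hJ z) (hR z) (hHm z) hVm' hi hj)
  · rw [← hD]
    exact Label.ext (hVmark j hj i hi) (hVstate i hi j hj) (vPair_eq hN (hR z) hi hj)
      (vSym_eq hN (hI z) (hJ z) (hR z) (hHm z) hVm' hi hj)

/-- With this offset the coordinates of the cells in every block are their places in it, so the
constraints are those of `exists_labels_eq`. -/
theorem block_mem_of_offset (hN : LargeEnough N) (hU : IsTiling (tileSet N) U)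
    {o : Fin N × Fin N} (ho1 : (U 0).left.1 + ((o.1 : ℕ) : ZMod N) = 0)
    (ho2 : (U 0).bottom.1 + ((o.2 : ℕ) : ZMod N) = 0) (z : ℤ × ℤ) :
    block U o z ∈ macroTile N '' tileSet N := by
  have h1 := hN.one_lt
  let q : ℤ × ℤ → ℕ → ℕ → ℤ × ℤ := fun z i j =>
    ((o.1 : ℤ) + N * z.1 + (i : ℤ), (o.2 : ℤ) + N * z.2 + (j : ℤ))
  have hq1 : ∀ z i j, q z i j + (1, 0) = q z (i + 1) j := fun z i j => by
    ext <;> simp [q]; ring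
  have hq2 : ∀ z i j, q z i j + (0, 1) = q z i (j + 1) := fun z i j => by
    ext <;> simp [q]; ring
  have hx : ∀ z i j, i < N → (U (q z i j)).left.1.val = i := by
    intro z i j hi
    have : (U (q z i j)).left.1 = (i : ZMod N) := by
      rw [(hU.coordinates h1 _).1]
      simp only [q]
      push_cast
      simp only [ZMod.natCast_self, zero_mul, add_zero]
      rw [← add_assoc, ho1, zero_add]
    rw [this, ZMod.val_natCast_of_lt hi]
  have hy : ∀ z i j, j < N → (U (q z i j)).bottom.1.val = j := by
    intro z i j hj
    have : (U (q z i j)).bottom.1 = (j : ZMod N) := by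
      rw [(hU.coordinates h1 _).2]
      simp only [q]
      push_cast
      simp only [ZMod.natCast_self, zero_mul, add_zero]
      rw [← add_assoc, ho2, zero_add]
    rw [this, ZMod.val_natCast_of_lt hj]
  have hcell : ∀ z, ∀ i < N, ∀ j < N, _ := fun z i hi j hj => hU.eq_cell (q z i j)
  obtain ⟨I, hI, J, hJ, l, r, d, u, hR, hH, hV⟩ := exists_labels_eq hN
    (H := fun z i j => (U (q z i j)).left.2.2) (V := fun z i j => (U (q z i j)).bottom.2.2)
    (fun z i hi j hj => by
      have := (hcell z i hi j hj).1
      rwa [hx z i j hi, hy z i j hj, hq1, hq2] at this)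
    (fun z j => by
      have : q z N j = q (z + (1, 0)) 0 j := by ext <;> simp [q]; ring
      simp only [this])
    (fun z i => by
      have : q z i N = q (z + (0, 1)) i 0 := by ext <;> simp [q]; ring
      simp only [this]) z
  refine ⟨cell N I J l r d u, ⟨I, hI, J, hJ, l, r, d, u, hR, rfl⟩, ?_⟩
  funext i j
  rw [macroTile_cell hI hJ l r d u i j rfl]
  have := (hcell z i i.2 j j.2).2
  rw [hx z i j i.2, hy z i j j.2, hq1, hq2] at this
  rw [← hH i i.2.le j j.2, ← hH (i + 1) i.2 j j.2, ← hV i i.2 j j.2.le, ← hV i i.2 (j + 1) j.2,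
    ← this]
  rfl

/-- The lower left cell of a macro-tile has both coordinates 0, so a single block already determines
the grid. -/
theorem offset_of_block_mem (hN : LargeEnough N) (hU : IsTiling (tileSet N) U)
    {o : Fin N × Fin N} (h : block U o 0 ∈ macroTile N '' tileSet N) :
    (U 0).left.1 + ((o.1 : ℕ) : ZMod N) = 0 ∧ (U 0).bottom.1 + ((o.2 : ℕ) : ZMod N) = 0 := by
  have h1 := hN.one_lt
  obtain ⟨t, -, ht⟩ := h
  have h0 := congrFun (congrFun ht ⟨0, by omega⟩) ⟨0, by omega⟩
  obtain ⟨hx, hy⟩ := hU.coordinates h1 ((o.1 : ℤ), (o.2 : ℤ))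
  simp only [block, macroTile, Prod.fst_zero, Prod.snd_zero, mul_zero, add_zero,
    Nat.cast_zero] at h0
  rw [← h0] at hx hy
  simp only [cell, Nat.cast_zero, Int.cast_natCast] at hx hy
  exact ⟨hx.symm, hy.symm⟩

theorem simulates_tileSet (hN : LargeEnough N) :
    Simulates (tileSet N) (macroTile N '' tileSet N) := by
  have : NeZero N := ⟨by have := hN.one_lt; omega⟩
  refine ⟨?_, exists_isTiling_tileSet hN, fun U hU => ?_⟩
  · rintro _ ⟨t, ht, rfl⟩
    exact isMacroTile_macroTile hN ht
  · refine ⟨(⟨(-(U 0).left.1).val, ZMod.val_lt _⟩, ⟨(-(U 0).bottom.1).val, ZMod.val_lt _⟩),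
      block_mem_of_offset hN hU (by simp) (by simp), fun o ho => ?_⟩
    obtain ⟨h1, h2⟩ := offset_of_block_mem hN hU (ho 0)
    refine Prod.ext (Fin.ext ?_) (Fin.ext ?_)
    · dsimp only
      rw [neg_eq_of_add_eq_zero_right h1, ZMod.val_natCast_of_lt o.1.2]
    · dsimp only
      rw [neg_eq_of_add_eq_zero_right h2, ZMod.val_natCast_of_lt o.2.2]

theorem isSelfSimilar_tileSet (hN : LargeEnough N) : IsSelfSimilar (tileSet N) N :=
  ⟨hN.one_lt, macroTile N '' tileSet N, simulates_tileSet hN,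
    Equiv.Set.imageOfInjOn _ _ (macroTile_injOn hN),
    fun s t => macroTile_hMatch hN s.2 t.2, fun s t => macroTile_vMatch hN s.2 t.2⟩

end Tilings

end FixedPointTiling

theorem mainTheorem2 :
    ∃ N₀ : ℕ, ∀ N : ℕ, N₀ ≤ N →
      ∃ (C : Type) (_ : Fintype C) (τ : Set (FixedPointTiling.Tile C)),
        FixedPointTiling.IsSelfSimilar τ N ∧
        (∃ U, FixedPointTiling.IsTiling τ U) ∧
        (∀ U, FixedPointTiling.IsTiling τ U → ¬ FixedPointTiling.IsPeriodic U) := by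
  refine ⟨Fintype.card FixedPointTiling.DataIdx + Fintype.card FixedPointTiling.ColIdx + 5,
    fun N hN => ?_⟩
  have hL : FixedPointTiling.LargeEnough N := hN
  have : NeZero N := ⟨by have := hL.one_lt; omega⟩
  have hS := FixedPointTiling.isSelfSimilar_tileSet hL
  exact ⟨FixedPointTiling.Color N, inferInstance, FixedPointTiling.tileSet N, hS,
    FixedPointTiling.exists_isTiling_tileSet hL, fun U hU => hS.not_isPeriodic hU⟩
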